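/- Let $D>1$ be a square-free product of an even number of primes, let $M\ge 1$ be a square-free integer prime to $D$, and let $B$ be the (indefinite) quaternion algebra over $\mathbb{Q}$ of discriminant $D$. Let $K$ be a real quadratic field of discriminant $d_K$ in which all primes dividing $D$ are inert and all primes dividing $M$ split, let $\mathcal{O}_K$ be its ring of integers and $\tau$ the generator of $\mathrm{Gal}(K/\mathbb{Q})$. Let $R\subset B$ be an Eichler order of level $M$, let $\Gamma$ be the group of elements of $R$ of reduced norm $1$, let $\omega_\infty\in R$ have reduced norm $-1$, and let $\omega_{MD}\in R$ be an Atkin--Lehner element, i.e. an element of reduced norm $MD$ that normalizes $R$. Let $G=\mathrm{Pic}^+(\mathcal{O}_K)$ be the narrow class group of $K$ (identified by class field theory with the Galois group over $K$ of the narrow Hilbert class field). For embeddings of $K$ into $B$ write $\psi\sim\psi'$ if $\psi'=\gamma\psi\gamma^{-1}$ for some $\gamma\in\Gamma$, and let $[\psi]$ be the class of $\psi$. An embedding $\psi:K\hookrightarrow B$ is optimal if $\psi(K)\cap R=\psi(\mathcal{O}_K)$. The group $G$ acts on classes of optimal embeddings: if $\mathfrak{a}\subset\mathcal{O}_K$ is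 a nonzero ideal with class $\sigma_{\mathfrak a}\in G$ and $a\in R$ has positive reduced norm and satisfies $R\psi(\mathfrak{a})=Ra$, then $\sigma_{\mathfrak a}\star[\psi]=[a\psi a^{-1}]$. (1) Let $\psi$ be an optimal embedding and let $\mathfrak{a}\subset\mathcal{O}_K$ be a nonzero ideal with $$[\omega_\infty(\psi\circ\tau)\omega_\infty^{-1}]=[\omega_{MD}(\sigma_{\mathfrak a}\star\psi)\omega_{MD}^{-1}].$$ Then there is an isomorphism of quaternion algebras over $\mathbb{Q}$ $$B\simeq\left(\frac{d_K,\;MD\,\mathrm{N}_{K/\mathbb{Q}}(\mathfrak{a})}{\mathbb{Q}}\right).$$ Moreover, if $\mathfrak{b}\subset\mathcal{O}_K$ is a nonzero ideal such that $B\simeq\left(\frac{d_K,\;MD\,\mathrm{N}_{K/\mathbb{Q}}(\mathfrak{b})}{\mathbb{Q}}\right)$, then $\sigma_{\mathfrak a}$ and $\sigma_{\mathfrak b}$ have the same image in $G/G^2$. (2) For an optimal embedding $\psi$ let $\sigma_\psi\in G$ be the element with $\psi\circ\tau\sim\omega_{MD}(\sigma_\psi\star\psi)\omega_{MD}^{-1}$.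 The class $\bar\sigma$ of $\sigma_\psi$ in $G/G^2$ does not depend on $\psi$. (3) Let $\chi:G\to\{\pm1\}$ be the genus character of $K$ associated with a pair $(\chi_1,\chi_2)$; that is, $d_K=d_1d_2$ with $d_1,d_2$ coprime discriminants (the value $1$ being allowed), $\chi_i$ is the quadratic Dirichlet character attached to $\mathbb{Q}(\sqrt{d_i})$, and $\chi$ cuts out the field $\mathbb{Q}(\sqrt{d_1},\sqrt{d_2})$, in the sense that a nonzero prime $\mathfrak p$ of $\mathcal O_K$ splits completely in this field if and only if $\chi(\sigma_{\mathfrak p})=1$. Then $$\chi(\bar\sigma)=\chi_1(-MD).$$ -/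

import Mathlib

open scoped Quaternion nonZeroDivisors NumberField

/-! ### Quaternion algebras over `ℚ`, orders, Eichler orders

`ℍ[ℚ,α,β]` is the quaternion algebra `(α, β / ℚ)` with `i² = α`, `j² = β`, `ij = -ji`.  Every
quaternion algebra over `ℚ` is of this form, with `α` and `β` non-zero. -/

/-- The reduced norm `x ↦ x x̄` of the quaternion algebra `(α, β / ℚ)`. -/
def reducedNorm {α β : ℚ} (x : ℍ[ℚ,α,β]) : ℚ := (x * star x).re

/-- `(α, β / ℚ)` is ramified at the prime `ℓ`: its base change `(α, β / ℚ_ℓ)` is a division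
algebra. -/
def IsRamifiedAt (α β : ℚ) (ℓ : ℕ) [Fact ℓ.Prime] : Prop :=
  ∀ x : ℍ[ℚ_[ℓ],(α : ℚ_[ℓ]),(β : ℚ_[ℓ])], x ≠ 0 → IsUnit x

/-- `(α, β / ℚ)` is a quaternion algebra of discriminant `D`: `D` is the product of the primes at
which it is ramified. -/
structure HasQuaternionDiscriminant (α β : ℚ) (D : ℕ) : Prop where
  left_ne_zero : α ≠ 0
  right_ne_zero : β ≠ 0
  squarefree : Squarefree D
  ramified_iff : ∀ (ℓ : ℕ) [Fact ℓ.Prime], IsRamifiedAt α β ℓ ↔ ℓ ∣ D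

/-- A `ℤ`-order of a `ℚ`-algebra: a subring that is a full `ℤ`-lattice. -/
structure IsZOrder {B : Type*} [Ring B] [Algebra ℚ B] (O : Subring B) : Prop where
  finite : Module.Finite ℤ O
  span_eq_top : Submodule.span ℚ (O : Set B) = ⊤

/-- A maximal `ℤ`-order. -/
structure IsMaximalZOrder {B : Type*} [Ring B] [Algebra ℚ B] (O : Subring B) : Prop where
  isZOrder : IsZOrder O
  eq_of_le : ∀ O' : Subring B, IsZOrder O' → O ≤ O' → O' = O

/-- An Eichler order of level `M`: the intersection of two maximal orders, of index `M` in each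
of them. -/
def IsEichlerOrder {B : Type*} [Ring B] [Algebra ℚ B] (R : Subring B) (M : ℕ) : Prop :=
  ∃ O₁ O₂ : Subring B, IsMaximalZOrder O₁ ∧ IsMaximalZOrder O₂ ∧ R = O₁ ⊓ O₂ ∧
    R.toAddSubgroup.relIndex O₁.toAddSubgroup = M ∧
    R.toAddSubgroup.relIndex O₂.toAddSubgroup = M

/-- An Atkin–Lehner element `ω_m` of `R`: an element of `R` of reduced norm `m` that normalizes
`R`.  If `R` is an Eichler order of square-free level `M` in an algebra of discriminant `D` and
`m = MD`, any product, in any order, of elements `ω_ℓ` as above for the primes `ℓ ∣ MD` is such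
an element, and `ω_{MD}` is unique up to multiplication by units of `R` of reduced norm `1`. -/
structure IsAtkinLehnerElement {α β : ℚ} (R : Subring ℍ[ℚ,α,β]) (m : ℕ)
    (ω : ℍ[ℚ,α,β]ˣ) : Prop where
  mem : (ω : ℍ[ℚ,α,β]) ∈ R
  norm_eq : reducedNorm (ω : ℍ[ℚ,α,β]) = m
  normalizes : ∀ x : ℍ[ℚ,α,β], (ω : ℍ[ℚ,α,β]) * x * (ω⁻¹ : ℍ[ℚ,α,β]ˣ) ∈ R ↔ x ∈ R

/-! ### The narrow class group -/

/-- The totally positive elements of `Kˣ`. -/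
def totallyPositiveUnits (K : Type*) [Field K] : Subgroup Kˣ where
  carrier := {x | ∀ φ : K →+* ℝ, 0 < φ x}
  one_mem' := by intro φ; simp
  mul_mem' := by
    intro x y hx hy φ
    simpa using mul_pos (hx φ) (hy φ)
  inv_mem' := by
    intro x hx φ
    simpa using hx φ

/-- The narrow class group `Pic⁺(𝓞 K)`: invertible fractional ideals modulo the principal
ideals that are generated by a totally positive element. -/
abbrev NarrowClassGroup (K : Type*) [Field K] [NumberField K] : Type _ :=
  (FractionalIdeal (𝓞 K)⁰ K)ˣ ⧸ (totallyPositiveUnits K).map (toPrincipalIdeal (𝓞 K) K)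

/-- The narrow class of a non-zero integral ideal. -/
noncomputable def narrowClass {K : Type*} [Field K] [NumberField K] (I : (Ideal (𝓞 K))⁰) :
    NarrowClassGroup K :=
  QuotientGroup.mk (FractionalIdeal.mk0 K I)

/-- The quotient `G / G²` of a commutative group. -/
abbrev ModSquares (G : Type*) [CommGroup G] : Type _ := G ⧸ (powMonoidHom 2 : G →* G).range

/-! ### Optimal embeddings and the action of the narrow class group -/

section Embeddings

variable {K : Type*} [Field K] [NumberField K] {α β : ℚ}

/-- `ψ` is an optimal embedding of `𝓞 K` into `R`: `ψ(K) ∩ R = ψ(𝓞 K)`. -/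
def IsOptimalEmbedding (R : Subring ℍ[ℚ,α,β]) (ψ : K →ₐ[ℚ] ℍ[ℚ,α,β]) : Prop :=
  Set.range ψ ∩ (R : Set ℍ[ℚ,α,β]) = Set.range fun x : 𝓞 K => ψ (x : K)

/-- The conjugate embedding `u ψ u⁻¹`. -/
def conjEmbedding (u : ℍ[ℚ,α,β]ˣ) (ψ : K →ₐ[ℚ] ℍ[ℚ,α,β]) : K →ₐ[ℚ] ℍ[ℚ,α,β] where
  toFun x := u * ψ x * (u⁻¹ : ℍ[ℚ,α,β]ˣ)
  map_one' := by simp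
  map_mul' x y := by simp [mul_assoc]
  map_zero' := by simp
  map_add' x y := by simp [mul_add, add_mul]
  commutes' r := by
    simp only [AlgHom.commutes]
    rw [← Algebra.commutes, mul_assoc, Units.mul_inv, mul_one]

/-- `ψ ∼ ψ'`: the two embeddings are conjugate under the group `Γ` of elements of `R` of
reduced norm `1`. -/
def GammaConj (R : Subring ℍ[ℚ,α,β]) (ψ ψ' : K →ₐ[ℚ] ℍ[ℚ,α,β]) : Prop :=
  ∃ γ : ℍ[ℚ,α,β]ˣ, (γ : ℍ[ℚ,α,β]) ∈ R ∧ reducedNorm (γ : ℍ[ℚ,α,β]) = 1 ∧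
    ψ' = conjEmbedding γ ψ

/-- `φ ∈ c ⋆ [ψ]` for a narrow ideal class `c`: if the ideal `𝔞` represents `c` and `a` is a
generator of positive reduced norm of the left ideal `R ψ(𝔞)`, then `c ⋆ [ψ]` is the
`Γ`-conjugacy class of `a ψ a⁻¹`. -/
def MemStar (R : Subring ℍ[ℚ,α,β]) (c : NarrowClassGroup K) (ψ φ : K →ₐ[ℚ] ℍ[ℚ,α,β]) : Prop :=
  ∃ (I : (Ideal (𝓞 K))⁰) (a : ℍ[ℚ,α,β]ˣ), narrowClass I = c ∧
    0 < reducedNorm (a : ℍ[ℚ,α,β]) ∧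
    Submodule.span R ((fun x : 𝓞 K => ψ (x : K)) '' ((I : Ideal (𝓞 K)) : Set (𝓞 K))) =
      Submodule.span R {(a : ℍ[ℚ,α,β])} ∧
    GammaConj R (conjEmbedding a ψ) φ

/-- `σ = σ_ψ`, i.e. `ψ ∘ τ ∼ ω_{MD} (σ ⋆ ψ) ω_{MD}⁻¹`. -/
def IsSigma (R : Subring ℍ[ℚ,α,β]) (τ : K ≃ₐ[ℚ] K) (ω : ℍ[ℚ,α,β]ˣ)
    (ψ : K →ₐ[ℚ] ℍ[ℚ,α,β]) (σ : NarrowClassGroup K) : Prop :=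
  ∃ φ : K →ₐ[ℚ] ℍ[ℚ,α,β], MemStar R σ ψ φ ∧
    GammaConj R (conjEmbedding ω φ) (ψ.comp (τ : K →ₐ[ℚ] K))

/-- `σ = σ_𝔞`, i.e. `[(ψ ∘ τ)^*] = [ω_{MD} (σ ⋆ ψ) ω_{MD}⁻¹]`, where
`(ψ ∘ τ)^* = ω_∞ (ψ ∘ τ) ω_∞⁻¹`. -/
def IsSigmaStar (R : Subring ℍ[ℚ,α,β]) (τ : K ≃ₐ[ℚ] K) (ωinf ω : ℍ[ℚ,α,β]ˣ)
    (ψ : K →ₐ[ℚ] ℍ[ℚ,α,β]) (σ : NarrowClassGroup K) : Prop :=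
  ∃ φ : K →ₐ[ℚ] ℍ[ℚ,α,β], MemStar R σ ψ φ ∧
    GammaConj R (conjEmbedding ω φ) (conjEmbedding ωinf (ψ.comp (τ : K →ₐ[ℚ] K)))

end Embeddings

/-! ### Genus characters -/

/-- `d` is a discriminant (the value `d = 1` is allowed). -/
def IsDiscr (d : ℤ) : Prop := d % 4 = 0 ∨ d % 4 = 1

/-- `χ` is the quadratic Dirichlet character, modulo `|d|`, associated with `ℚ(√d)`: it is given
by the Jacobi symbol `(d / n)` at odd positive integers `n`. -/
def IsQuadraticCharacterOf (d : ℤ) (χ : DirichletCharacter ℤ d.natAbs) : Prop :=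
  ∀ n : ℕ, Odd n → χ (n : ZMod d.natAbs) = jacobiSym d n

/-- The field `K(√d₁, √d₂)`, which is `ℚ(√d₁, √d₂)` if `d₁ d₂` is the discriminant of the
quadratic field `K`. -/
noncomputable abbrev genusField (K : Type*) [Field K] (d₁ d₂ : ℤ) :
    IntermediateField K (AlgebraicClosure K) :=
  IntermediateField.adjoin K {x | x ^ 2 = (d₁ : AlgebraicClosure K) ∨
    x ^ 2 = (d₂ : AlgebraicClosure K)}

/-- The prime `𝔭` of `K` splits completely in the finite extension `L` of `K`. -/
def SplitsCompletely {K : Type*} [Field K] (𝔭 : Ideal (𝓞 K))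
    (L : Type*) [Field L] [Algebra K L] : Prop :=
  (𝔭.primesOver (𝓞 L)).ncard = Module.finrank K L

/-- The character `χ : Pic⁺(𝓞 K) → {±1}` is the genus character of the quadratic field `K`
associated with the pair `(χ₁, χ₂)`: one has `d_K = d₁ d₂` with coprime discriminants `d₁, d₂`,
`χᵢ` is the character associated with `ℚ(√dᵢ)`, and `χ` cuts out the field `ℚ(√d₁, √d₂)`, that
is, the primes of `K` whose class is in the kernel of `χ` are those that split completely in
this field. -/
structure IsGenusCharacter {K : Type*} [Field K] [NumberField K] (χ : NarrowClassGroup K →* ℤˣ)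
    (d₁ d₂ : ℤ) (χ₁ : DirichletCharacter ℤ d₁.natAbs) (χ₂ : DirichletCharacter ℤ d₂.natAbs) :
    Prop where
  discr_left : IsDiscr d₁
  discr_right : IsDiscr d₂
  coprime : IsCoprime d₁ d₂
  mul_eq : d₁ * d₂ = NumberField.discr K
  character_left : IsQuadraticCharacterOf d₁ χ₁
  character_right : IsQuadraticCharacterOf d₂ χ₂
  cuts_out : ∀ 𝔭 : (Ideal (𝓞 K))⁰, (𝔭 : Ideal (𝓞 K)).IsPrime →
    (χ (narrowClass 𝔭) = 1 ↔ SplitsCompletely (𝔭 : Ideal (𝓞 K)) (genusField K d₁ d₂))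

/-!
Everything follows from one element of `B`. Unwinding the definitions of `⋆` and of `Γ`-conjugacy,
the relation that defines `σ` provides an ideal `I` of class `σ` and a `b ∈ B` such that
`b ψ b⁻¹ = ψ ∘ τ`, of reduced norm `MD · N(I)` up to sign; the sign is `-1` in the presence of `ω_∞`
(`IsSigma.exists_intertwiner`, `IsSigmaStar.exists_intertwiner`). The only arithmetic of the order
that is used is that a generator `a` of `R ψ(I)` has reduced norm `N(I)` (`reducedNorm_generator`):
the involution of `B` restricts to the conjugation of `K`, and `I · τ(I) = (N(I))`.

As `b` anticommutes with `ψ(√d_K)`, it is pure and `b² = -nrd(b)`, so that `ψ(√d_K)` and `b` are the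
standard generators of `(d_K, -nrd(b) / ℚ)`; replacing `b` by `ψ(z) b` multiplies `b²` by `N(z)`,
which allows `I` to be replaced by any ideal of the same narrow class (`intertwiner_mul_self`). This
is the isomorphism in the first part. Conversely, two isomorphic algebras `(d_K, m / ℚ)` and
`(d_K, m' / ℚ)`, of which one is a division algebra, have `m' / m` a norm from `K`
(`exists_norm_ratio`), and ideals whose norms differ by the norm of an element have the same class in
`G / G²` (`narrowClass_modSquares_of_norm`): if `I` and `J` have equal norms, then
`C = I + J` satisfies `C · τ(I) = J · τ(C)`, and `τ` acts on classes as inversion. This gives the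
uniqueness in the first part, and the second part.

For the third part, `I` is chosen of norm prime to `d₁`. Then `χ(σ) = χ₁(N(I))`
(`IsGenusCharacter.apply_narrowClass`), by the splitting law of primes in `K(√d₁)` and
multiplicativity. On the other hand `B ≃ (d_K, -MD · N(I) / ℚ)` is unramified at the primes dividing
`d₁`, since the primes dividing `D` are inert in `K`. Hence `-MD · N(I)` is a local norm at these
primes, which forces it to be a square modulo each odd `p ∣ d₁`, with a condition modulo `8` at `2`;
by quadratic reciprocity `χ₁(-MD · N(I)) = 1` (`quadraticCharacter_eq_one_of_local`,
`IsGenusCharacter.character_left_eq_one`), and so `χ₁(-MD) = χ₁(N(I)) = χ(σ)`.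
-/

/-! ### Quaternion algebras -/

section QuaternionGeneral

variable {F : Type*} [Field F] [CharZero F]

/-- The quaternion algebra `(a, b / F)` is simple: an element of the kernel has zero real part, since
`4ab re x` is a combination of `x`, `ixi`, `jxj` and `kxk`, and the other coordinates are
real parts of multiples of `x`. -/
theorem QuaternionAlgebra.algHom_injective {A : Type*} [Ring A] [Nontrivial A] [Algebra F A]
    {a b : F} (ha : a ≠ 0) (hb : b ≠ 0) (f : ℍ[F,a,b] →ₐ[F] A) : Function.Injective f := by
  have key : ∀ x : ℍ[F,a,b], f x = 0 → x.re = 0 := by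
    intro x hx
    have h : algebraMap F ℍ[F,a,b] (4 * a * b * x.re) =
        (a * b) • x + b • ((⟨0, 1, 0, 0⟩ : ℍ[F,a,b]) * x * ⟨0, 1, 0, 0⟩) +
          a • ((⟨0, 0, 1, 0⟩ : ℍ[F,a,b]) * x * ⟨0, 0, 1, 0⟩) -
          (⟨0, 0, 0, 1⟩ : ℍ[F,a,b]) * x * ⟨0, 0, 0, 1⟩ := by
      ext <;> simp [QuaternionAlgebra.algebraMap_eq] <;> ring
    have h' := congrArg f h
    rw [AlgHom.commutes] at h'
    simp only [map_sub (f := f), map_add (f := f), map_smul (f := f), map_mul f, hx, mul_zero,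
      zero_mul, smul_zero, add_zero, sub_zero] at h'
    have := (FaithfulSMul.algebraMap_injective F A) (h'.trans (map_zero _).symm)
    simpa [ha, hb] using this
  refine (injective_iff_map_eq_zero f).2 fun x hx => ?_
  have h1 := key x hx
  have h2 := key (x * ⟨0, 1, 0, 0⟩) (by rw [map_mul, hx, zero_mul])
  have h3 := key (x * ⟨0, 0, 1, 0⟩) (by rw [map_mul, hx, zero_mul])
  have h4 := key (x * ⟨0, 0, 0, 1⟩) (by rw [map_mul, hx, zero_mul])
  ext
  · exact h1
  · simpa [ha, hb] using h2
  · simpa [ha, hb] using h3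
  · simpa [ha, hb] using h4

/-- The homomorphism from `(a, b / F)` determined by an anticommuting pair with squares `a`, `b`. -/
noncomputable def QuaternionAlgebra.homOfPair {A : Type*} [Ring A] [Algebra F A] {a b : F} (i j : A)
    (hi : i * i = algebraMap F A a) (hj : j * j = algebraMap F A b) (hij : j * i = -(i * j)) :
    ℍ[F,a,b] →ₐ[F] A :=
  QuaternionAlgebra.Basis.liftHom
    { i := i, j := j, k := i * j
      i_mul_i := by rw [hi, Algebra.algebraMap_eq_smul_one, zero_smul, add_zero]
      j_mul_j := by rw [hj, Algebra.algebraMap_eq_smul_one]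
      i_mul_j := rfl
      j_mul_i := by rw [hij, zero_smul, zero_sub] }

theorem QuaternionAlgebra.homOfPair_bijective {a b a' b' : F} (ha : a ≠ 0) (hb : b ≠ 0)
    (i j : ℍ[F,a',b'])
    (hi : i * i = algebraMap F _ a) (hj : j * j = algebraMap F _ b) (hij : j * i = -(i * j)) :
    Function.Bijective (homOfPair i j hi hj hij) := by
  have hinj := algHom_injective ha hb (homOfPair i j hi hj hij)
  refine ⟨hinj, ?_⟩
  have := (LinearMap.injective_iff_surjective_of_finrank_eq_finrank
    (f := (homOfPair i j hi hj hij).toLinearMap) (by simp [QuaternionAlgebra.finrank_eq_four])).1 hinj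
  exact this

/-- The isomorphism from `(a, b / F)` onto a quaternion algebra, determined by an anticommuting
pair with squares `a`, `b`. -/
noncomputable def QuaternionAlgebra.equivOfPair {a b a' b' : F} (ha : a ≠ 0) (hb : b ≠ 0)
    (i j : ℍ[F,a',b'])
    (hi : i * i = algebraMap F _ a) (hj : j * j = algebraMap F _ b) (hij : j * i = -(i * j)) :
    ℍ[F,a,b] ≃ₐ[F] ℍ[F,a',b'] :=
  AlgEquiv.ofBijective (homOfPair i j hi hj hij) (homOfPair_bijective ha hb i j hi hj hij)

/-- The base change map `(α, β / ℚ) → (α, β / F)`. -/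
noncomputable def QuaternionAlgebra.baseChange (F : Type*) [Field F] [CharZero F] (α β : ℚ) :
    ℍ[ℚ,α,β] →ₐ[ℚ] ℍ[F,(α : F),(β : F)] :=
  homOfPair ⟨0, 1, 0, 0⟩ ⟨0, 0, 1, 0⟩
    (by rw [IsScalarTower.algebraMap_apply ℚ F]; ext <;> simp [QuaternionAlgebra.algebraMap_eq])
    (by rw [IsScalarTower.algebraMap_apply ℚ F]; ext <;> simp [QuaternionAlgebra.algebraMap_eq])
    (by ext <;> simp)

end QuaternionGeneral

section RationalQuaternion

variable {α β : ℚ}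

theorem mul_star_eq_reducedNorm (x : ℍ[ℚ,α,β]) :
    x * star x = algebraMap ℚ ℍ[ℚ,α,β] (reducedNorm x) :=
  QuaternionAlgebra.mul_star_eq_coe x

theorem reducedNorm_mul (x y : ℍ[ℚ,α,β]) :
    reducedNorm (x * y) = reducedNorm x * reducedNorm y := by
  simp [reducedNorm]; ring

theorem reducedNorm_one : reducedNorm (1 : ℍ[ℚ,α,β]) = 1 := by simp [reducedNorm]

/-- A quaternion algebra of discriminant greater than `1` is a division algebra. -/
theorem HasQuaternionDiscriminant.eq_zero_of_reducedNorm {D : ℕ} (hD : 1 < D)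
    (hB : HasQuaternionDiscriminant α β D) (x : ℍ[ℚ,α,β]) (hx : reducedNorm x = 0) : x = 0 := by
  obtain ⟨ℓ, hℓ, hdvd⟩ := Nat.exists_prime_and_dvd hD.ne'
  have : Fact ℓ.Prime := ⟨hℓ⟩
  have hram := (hB.ramified_iff ℓ).2 hdvd
  let f := QuaternionAlgebra.baseChange ℚ_[ℓ] α β
  have hinj : Function.Injective f :=
    QuaternionAlgebra.algHom_injective hB.left_ne_zero hB.right_ne_zero f
  by_contra h0
  have hu : IsUnit (f x) := hram _ fun h => h0 (hinj (h.trans (map_zero f).symm))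
  have h1 : f x * f (star x) = 0 := by
    rw [← map_mul, mul_star_eq_reducedNorm, hx, map_zero, map_zero]
  have h2 : star x = 0 := hinj (((hu.mul_right_eq_zero).1 h1).trans (map_zero f).symm)
  exact h0 (star_eq_zero.1 h2)

theorem noZeroDivisors_of_reducedNorm (h : ∀ x : ℍ[ℚ,α,β], reducedNorm x = 0 → x = 0) :
    NoZeroDivisors ℍ[ℚ,α,β] where
  eq_zero_or_eq_zero_of_mul_eq_zero := by
    intro x y hxy
    have h1 : reducedNorm x * reducedNorm y = 0 := by
      rw [← reducedNorm_mul, hxy]; simp [reducedNorm]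
    exact (mul_eq_zero.1 h1).imp (h x) (h y)

theorem re_eq_zero_of_anticommute {x y : ℍ[ℚ,α,β]} (hy : reducedNorm y ≠ 0)
    (h : y * x = -(x * y)) : x.re = 0 := by
  have h1 : (y * x * star y).re = reducedNorm y * x.re := by
    simp [reducedNorm]; ring
  have h2 : (x * y * star y).re = reducedNorm y * x.re := by
    simp [reducedNorm]; ring
  rw [h, neg_mul, QuaternionAlgebra.re_neg, h2] at h1
  have : reducedNorm y * x.re = 0 := by linarith
  exact (mul_eq_zero.1 this).resolve_left hy

theorem mul_self_of_re_eq_zero {x : ℍ[ℚ,α,β]} (h : x.re = 0) :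
    x * x = algebraMap ℚ _ (-reducedNorm x) := by
  rw [map_neg, ← mul_star_eq_reducedNorm, QuaternionAlgebra.star_eq_neg.2 h, mul_neg, neg_neg]

/-- In a division quaternion algebra `(d, m / ℚ)`, if `(d, m' / ℚ)` is isomorphic to it then `m'/m`
is a norm from `ℚ(√d)`: by Skolem–Noether the pair `(i', j')` may be conjugated so that `i' = i`,
and then `j'` lies in `ℚ(i) j`. -/
theorem exists_norm_ratio_self {d m m' : ℚ} (hd : d ≠ 0)
    (hdiv : ∀ x : ℍ[ℚ,d,m], reducedNorm x = 0 → x = 0) (i' j' : ℍ[ℚ,d,m])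
    (hi : i' * i' = algebraMap ℚ _ d) (hj : j' * j' = algebraMap ℚ _ m')
    (hij : j' * i' = -(i' * j')) (hj0 : j' ≠ 0) :
    ∃ x y : ℚ, m' = (x ^ 2 - d * y ^ 2) * m := by
  have hstar : star i' = -i' := QuaternionAlgebra.star_eq_neg.2
    (re_eq_zero_of_anticommute (fun h => hj0 (hdiv _ h)) hij)
  set i : ℍ[ℚ,d,m] := ⟨0, 1, 0, 0⟩ with hidef
  have hii : i * i = algebraMap ℚ _ d := by
    ext <;> simp [hidef, QuaternionAlgebra.algebraMap_eq]
  -- an element anticommuting with `i` is a combination of `j` and `k`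
  have main : ∀ w : ℍ[ℚ,d,m], ∀ c : ℚ, w * i = -(i * w) → w * w = algebraMap ℚ _ c →
      ∃ x y : ℚ, c = (x ^ 2 - d * y ^ 2) * m := by
    intro w c h1 h2
    have e1 := congrArg QuaternionAlgebra.re h1
    have e2 := congrArg QuaternionAlgebra.imI h1
    have e3 := congrArg QuaternionAlgebra.re h2
    simp [hidef, QuaternionAlgebra.algebraMap_eq] at e1 e2 e3
    have w2 : w.imI = 0 := by
      have : d * w.imI = 0 := by linarith
      exact (mul_eq_zero.1 this).resolve_left hd
    have w1 : w.re = 0 := by linarith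
    rw [w1, w2] at e3
    exact ⟨w.imJ, w.imK, by rw [← e3]; ring⟩
  by_cases hu : i + i' = 0
  · have hi' : i' = -i := (neg_eq_of_add_eq_zero_right hu).symm
    refine main j' m' ?_ hj
    rw [hi'] at hij
    rw [mul_neg, neg_mul, neg_neg] at hij
    rw [← hij, neg_neg]
  · set u := i + i' with hudef
    have hui : u * i' = i * u := by rw [hudef, add_mul, mul_add, hii, hi, add_comm]
    have hsu : star u = -u := by
      rw [hudef, star_add, hstar, (QuaternionAlgebra.star_eq_neg.2 rfl : star i = -i), neg_add]
    have hn : reducedNorm u ≠ 0 := fun h => hu (hdiv _ h)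
    have huu : u * u = algebraMap ℚ _ (-reducedNorm u) := by
      rw [map_neg, ← mul_star_eq_reducedNorm, hsu, mul_neg, neg_neg]
    have hiu : u * i = i' * u := by rw [hudef, add_mul, mul_add, hii, hi, add_comm]
    obtain ⟨x, y, h⟩ := main (u * j' * u) (m' * reducedNorm u ^ 2) (by
      rw [mul_assoc, mul_assoc, hiu, ← mul_assoc j', hij, neg_mul, mul_neg, ← mul_assoc,
        ← mul_assoc, hui]
      simp only [mul_assoc]) (by
      have : u * j' * u * (u * j' * u) = u * (j' * (u * u) * j') * u := by
        simp only [mul_assoc]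
      rw [this, huu, ← Algebra.commutes, mul_assoc (algebraMap ℚ _ _), hj, ← map_mul,
        ← Algebra.commutes, mul_assoc, huu, ← map_mul]
      congr 1; ring)
    refine ⟨x / reducedNorm u, y / reducedNorm u, ?_⟩
    field_simp
    linarith

/-- If anticommuting pairs with squares `(d, m)` and `(d, m')` both exist in a division quaternion
algebra, then `m' / m` is a norm from `ℚ(√d)`. -/
theorem exists_norm_ratio {d m m' : ℚ} (hd : d ≠ 0) (hm : m ≠ 0)
    (hdiv : ∀ x : ℍ[ℚ,α,β], reducedNorm x = 0 → x = 0) (i j i' j' : ℍ[ℚ,α,β])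
    (hi : i * i = algebraMap ℚ _ d) (hj : j * j = algebraMap ℚ _ m) (hij : j * i = -(i * j))
    (hi' : i' * i' = algebraMap ℚ _ d) (hj' : j' * j' = algebraMap ℚ _ m')
    (hij' : j' * i' = -(i' * j')) (hj0 : j' ≠ 0) :
    ∃ x y : ℚ, m' = (x ^ 2 - d * y ^ 2) * m := by
  have := noZeroDivisors_of_reducedNorm hdiv
  let e := QuaternionAlgebra.equivOfPair hd hm i j hi hj hij
  refine exists_norm_ratio_self hd (fun x hx => ?_) (e.symm i') (e.symm j') ?_ ?_ ?_ ?_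
  · have h1 : e x * e (star x) = 0 := by
      rw [← map_mul, mul_star_eq_reducedNorm, hx, map_zero, map_zero]
    rcases mul_eq_zero.1 h1 with h | h
    · exact (map_eq_zero_iff e e.injective).1 h
    · exact star_eq_zero.1 ((map_eq_zero_iff e e.injective).1 h)
  · rw [← map_mul, hi', AlgEquiv.commutes]
  · rw [← map_mul, hj', AlgEquiv.commutes]
  · rw [← map_mul, hij', map_neg, map_mul]
  · exact fun h => hj0 ((map_eq_zero_iff e.symm e.symm.injective).1 h)

/-! ### Integrality in an order -/

theorem IsIntegral.star_quaternion {x : ℍ[ℚ,α,β]} (hx : IsIntegral ℤ x) : IsIntegral ℤ (star x) := by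
  obtain ⟨p, hp, h⟩ := hx
  refine ⟨p, hp, ?_⟩
  rw [← Polynomial.aeval_def, Polynomial.aeval_eq_sum_range] at h ⊢
  have := congrArg star h
  simpa [star_sum, star_pow, (Int.cast_commute _ _).eq] using this

/-- The reduced trace and norm of an integral quaternion are integers. -/
theorem IsIntegral.exists_int_trace_norm {x : ℍ[ℚ,α,β]} (hx : IsIntegral ℤ x) :
    (∃ t : ℤ, x + star x = algebraMap ℚ _ (t : ℚ)) ∧ ∃ n : ℤ, reducedNorm x = n := by
  -- `x` and its conjugate lie in the commutative subalgebra `ℚ[x]`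
  let S := Algebra.adjoin ℚ ({x} : Set ℍ[ℚ,α,β])
  have : IsMulCommutative S := Algebra.isMulCommutative_adjoin ℚ (by
    intro a ha b hb; rw [Set.mem_singleton_iff.1 ha, Set.mem_singleton_iff.1 hb])
  have hxS : x ∈ S := Algebra.subset_adjoin rfl
  have htr : x + star x = algebraMap ℚ ℍ[ℚ,α,β] (2 * x.re) := by
    rw [QuaternionAlgebra.self_add_star', QuaternionAlgebra.coe_algebraMap, zero_mul, add_zero]
  have hsx : star x ∈ S := by
    have : star x = algebraMap ℚ _ (2 * x.re) - x := by rw [← htr]; abel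
    rw [this]; exact S.sub_mem (S.algebraMap_mem _) hxS
  have h1 : IsIntegral ℤ (⟨x, hxS⟩ : S) :=
    (isIntegral_algHom_iff (S.val.toRingHom.toIntAlgHom) Subtype.val_injective).1 hx
  have h2 : IsIntegral ℤ (⟨star x, hsx⟩ : S) :=
    (isIntegral_algHom_iff (S.val.toRingHom.toIntAlgHom) Subtype.val_injective).1 hx.star_quaternion
  have key : ∀ q : ℚ, ∀ y : S, (y : ℍ[ℚ,α,β]) = algebraMap ℚ _ q → IsIntegral ℤ y →
      ∃ n : ℤ, q = n := by
    intro q y hy hint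
    have h3 : IsIntegral ℤ (algebraMap ℚ ℍ[ℚ,α,β] q) := by
      rw [← hy]; exact hint.map (S.val.toRingHom.toIntAlgHom)
    have h4 : IsIntegral ℤ q :=
      (isIntegral_algHom_iff ((Algebra.ofId ℚ ℍ[ℚ,α,β]).toRingHom.toIntAlgHom)
        (FaithfulSMul.algebraMap_injective ℚ ℍ[ℚ,α,β])).1 h3
    obtain ⟨n, hn⟩ := IsIntegrallyClosed.isIntegral_iff.1 h4
    exact ⟨n, by rw [← hn]; rfl⟩
  constructor
  · obtain ⟨t, ht⟩ := key (2 * x.re) (⟨x, hxS⟩ + ⟨star x, hsx⟩) htr (h1.add h2)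
    exact ⟨t, by rw [htr, ht]⟩
  · exact key (reducedNorm x) (⟨x, hxS⟩ * ⟨star x, hsx⟩) (mul_star_eq_reducedNorm x) (h1.mul h2)

theorem IsEichlerOrder.isIntegral {R : Subring ℍ[ℚ,α,β]} {M : ℕ} (hR : IsEichlerOrder R M)
    {x : ℍ[ℚ,α,β]} (hx : x ∈ R) : IsIntegral ℤ x := by
  obtain ⟨O₁, O₂, h₁, -, rfl, -, -⟩ := hR
  have := h₁.isZOrder.finite
  have : IsIntegral ℤ (⟨x, hx.1⟩ : O₁) := IsIntegral.of_finite ℤ _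
  exact this.map O₁.subtype.toIntAlgHom

theorem IsEichlerOrder.star_mem {R : Subring ℍ[ℚ,α,β]} {M : ℕ} (hR : IsEichlerOrder R M)
    {x : ℍ[ℚ,α,β]} (hx : x ∈ R) : star x ∈ R := by
  obtain ⟨t, ht⟩ := (hR.isIntegral hx).exists_int_trace_norm.1
  have : star x = (t : ℍ[ℚ,α,β]) - x := by
    rw [eq_sub_iff_add_eq, add_comm, ht, map_intCast]
  rw [this]
  exact sub_mem (intCast_mem R t) hx

theorem IsEichlerOrder.exists_int_of_algebraMap_mem {R : Subring ℍ[ℚ,α,β]} {M : ℕ}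
    (hR : IsEichlerOrder R M) {q : ℚ} (hq : algebraMap ℚ ℍ[ℚ,α,β] q ∈ R) : ∃ n : ℤ, q = n := by
  have h4 : IsIntegral ℤ q :=
    (isIntegral_algHom_iff ((Algebra.ofId ℚ ℍ[ℚ,α,β]).toRingHom.toIntAlgHom)
      (FaithfulSMul.algebraMap_injective ℚ ℍ[ℚ,α,β])).1 (hR.isIntegral hq)
  obtain ⟨n, hn⟩ := IsIntegrallyClosed.isIntegral_iff.1 h4
  exact ⟨n, by rw [← hn]; rfl⟩

end RationalQuaternion

/-! ### Quadratic fields -/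

theorem IsDiscr.exists_four_mul {d : ℤ} (hd : IsDiscr d) : ∃ e : ℤ, d * (d - 1) = 4 * e := by
  rcases hd with h | h
  · exact ⟨d / 4 * (d - 1), by
      have : d = 4 * (d / 4) := by omega
      linear_combination (d - 1) * this⟩
  · exact ⟨d * (d / 4), by
      have : d - 1 = 4 * (d / 4) := by omega
      linear_combination d * this⟩

section QuadraticField

variable {K : Type*} [Field K] [NumberField K]

theorem isGalois_of_finrank_eq_two (hK : Module.finrank ℚ K = 2) : IsGalois ℚ K :=
  have : Algebra.IsQuadraticExtension ℚ K := ⟨hK⟩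
  inferInstance

open Classical in
theorem univ_aut_eq (hK : Module.finrank ℚ K = 2) {τ : K ≃ₐ[ℚ] K} (hτ : τ ≠ AlgEquiv.refl) :
    Finset.univ = ({AlgEquiv.refl, τ} : Finset (K ≃ₐ[ℚ] K)) := by
  have := isGalois_of_finrank_eq_two hK
  symm
  apply Finset.eq_univ_of_card
  rw [Finset.card_pair hτ.symm, ← Nat.card_eq_fintype_card, IsGalois.card_aut_eq_finrank, hK]

theorem algebraMap_norm_eq (hK : Module.finrank ℚ K = 2) {τ : K ≃ₐ[ℚ] K}
    (hτ : τ ≠ AlgEquiv.refl) (x : K) : algebraMap ℚ K (Algebra.norm ℚ x) = x * τ x := by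
  classical
  have := isGalois_of_finrank_eq_two hK
  rw [Algebra.norm_eq_prod_automorphisms, univ_aut_eq hK hτ, Finset.prod_pair hτ.symm]
  rfl

theorem algebraMap_trace_eq (hK : Module.finrank ℚ K = 2) {τ : K ≃ₐ[ℚ] K}
    (hτ : τ ≠ AlgEquiv.refl) (x : K) : algebraMap ℚ K (Algebra.trace ℚ K x) = x + τ x := by
  classical
  have := isGalois_of_finrank_eq_two hK
  rw [trace_eq_sum_automorphisms, univ_aut_eq hK hτ, Finset.sum_pair hτ.symm]
  rfl

theorem conj_conj (hK : Module.finrank ℚ K = 2) {τ : K ≃ₐ[ℚ] K}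
    (hτ : τ ≠ AlgEquiv.refl) (x : K) : τ (τ x) = x := by
  have h := congrArg τ (algebraMap_trace_eq hK hτ x)
  rw [AlgEquiv.commutes, map_add, algebraMap_trace_eq hK hτ, add_comm] at h
  exact (add_left_cancel h).symm

theorem exists_rat_of_conj_eq (hK : Module.finrank ℚ K = 2) {τ : K ≃ₐ[ℚ] K}
    (hτ : τ ≠ AlgEquiv.refl) {x : K} (hx : τ x = x) : ∃ q : ℚ, x = algebraMap ℚ K q := by
  refine ⟨Algebra.trace ℚ K x / 2, ?_⟩
  rw [map_div₀, algebraMap_trace_eq hK hτ, hx, map_ofNat]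
  ring

/-- The automorphism of the ring of integers induced by an automorphism of the field. -/
noncomputable abbrev conjInt (τ : K ≃ₐ[ℚ] K) : 𝓞 K ≃+* 𝓞 K :=
  NumberField.RingOfIntegers.mapRingEquiv (τ : K ≃+* K)

theorem intNorm_eq (hK : Module.finrank ℚ K = 2) {τ : K ≃ₐ[ℚ] K}
    (hτ : τ ≠ AlgEquiv.refl) (x : 𝓞 K) : ((Algebra.norm ℤ x : ℤ) : 𝓞 K) = x * conjInt τ x := by
  apply NumberField.RingOfIntegers.ext
  have h := algebraMap_norm_eq hK hτ (x : K)
  rw [← Algebra.coe_norm_int] at h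
  simpa using h

theorem intTrace_eq (hK : Module.finrank ℚ K = 2) {τ : K ≃ₐ[ℚ] K}
    (hτ : τ ≠ AlgEquiv.refl) (x : 𝓞 K) :
    ((Algebra.trace ℤ (𝓞 K) x : ℤ) : 𝓞 K) = x + conjInt τ x := by
  apply NumberField.RingOfIntegers.ext
  have h := algebraMap_trace_eq hK hτ (x : K)
  rw [← Algebra.coe_trace_int] at h
  simpa using h

/-- `s` is a square root of the discriminant of the quadratic field `K`, and every difference
`x - τ x` with `x` integral is an integral multiple of `s`. -/
structure IsSqrtDiscr (τ : K ≃ₐ[ℚ] K) (s : 𝓞 K) : Prop where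
  sq : s * s = (NumberField.discr K : 𝓞 K)
  conj : conjInt τ s = -s
  exists_sub_conj : ∀ x : 𝓞 K, ∃ k : ℤ, x - conjInt τ x = k * s

/-- For an integral basis `b₀, b₁`, the determinant `b₀ τ(b₁) - b₁ τ(b₀)` has the discriminant as its
square. As `1` is a combination of `b₀` and `b₁`, every `x - τ x = x τ(1) - 1 τ(x)` is a multiple of
it. -/
theorem exists_isSqrtDiscr (hK : Module.finrank ℚ K = 2) {τ : K ≃ₐ[ℚ] K}
    (hτ : τ ≠ AlgEquiv.refl) : ∃ s : 𝓞 K, IsSqrtDiscr τ s := by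
  have hrank : Module.finrank ℤ (𝓞 K) = 2 := by rw [NumberField.RingOfIntegers.rank, hK]
  let b : Module.Basis (Fin 2) ℤ (𝓞 K) := Module.finBasisOfFinrankEq ℤ (𝓞 K) hrank
  have hcc : ∀ x : 𝓞 K, conjInt τ (conjInt τ x) = x := fun x =>
    NumberField.RingOfIntegers.ext (conj_conj hK hτ (x : K))
  refine ⟨b 0 * conjInt τ (b 1) - b 1 * conjInt τ (b 0), ?_, ?_, ?_⟩
  · rw [← NumberField.discr_eq_discr K b, Algebra.discr_def, Matrix.det_fin_two]
    simp only [Algebra.traceMatrix_apply, Algebra.traceForm_apply, Int.cast_sub, Int.cast_mul,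
      intTrace_eq hK hτ, map_mul]
    ring
  · rw [map_sub, map_mul, map_mul, hcc, hcc]
    ring
  · intro x
    have h1 := b.sum_repr 1
    have hx := b.sum_repr x
    rw [Fin.sum_univ_two] at h1 hx
    simp only [zsmul_eq_mul] at h1 hx
    refine ⟨b.repr x 0 * b.repr 1 1 - b.repr x 1 * b.repr 1 0, ?_⟩
    have e1 := congrArg (conjInt τ) h1
    have ex := congrArg (conjInt τ) hx
    simp only [map_add, map_mul, map_intCast, map_one] at e1 ex
    push_cast
    linear_combination (-((b.repr 1 0 : 𝓞 K) * conjInt τ (b 0) + b.repr 1 1 * conjInt τ (b 1))) * hx -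
      x * e1 + ((b.repr 1 0 : 𝓞 K) * b 0 + b.repr 1 1 * b 1) * ex + conjInt τ x * h1

namespace IsSqrtDiscr

variable {τ : K ≃ₐ[ℚ] K} {s : 𝓞 K}

theorem coe_sq (hs : IsSqrtDiscr τ s) : (s : K) * s = algebraMap ℚ K (NumberField.discr K : ℚ) := by
  have := congrArg (fun x : 𝓞 K => (x : K)) hs.sq
  simpa using this

theorem coe_conj (hs : IsSqrtDiscr τ s) : τ (s : K) = -(s : K) := by
  have := congrArg (fun x : 𝓞 K => (x : K)) hs.conj
  simpa using this

theorem ne_zero (hs : IsSqrtDiscr τ s) : (s : K) ≠ 0 := by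
  intro h
  have := hs.coe_sq
  rw [h, mul_zero, eq_comm, map_eq_zero] at this
  exact NumberField.discr_ne_zero K (by exact_mod_cast this)

theorem exists_rat_add (hs : IsSqrtDiscr τ s) (hK : Module.finrank ℚ K = 2)
    (hτ : τ ≠ AlgEquiv.refl) (x : K) :
    ∃ p q : ℚ, x = algebraMap ℚ K p + algebraMap ℚ K q * s := by
  obtain ⟨q, hq⟩ := exists_rat_of_conj_eq hK hτ (x := (x - τ x) / s) (by
    rw [map_div₀, map_sub, conj_conj hK hτ, hs.coe_conj, div_neg, ← neg_div, neg_sub])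
  refine ⟨Algebra.trace ℚ K x / 2, q / 2, ?_⟩
  rw [map_div₀, map_div₀, ← hq, algebraMap_trace_eq hK hτ, map_ofNat]
  have := hs.ne_zero
  field_simp
  ring

/-- The discriminant of a quadratic field is fundamental: dividing it by a square other than `1`
does not give a discriminant `c`. Otherwise `(c + √c)/2` would be an integer of `K`, and the
difference with its conjugate not an integral multiple of `s`. -/
theorem fundamental (hs : IsSqrtDiscr τ s) {p c : ℤ} (h : NumberField.discr K = p ^ 2 * c)
    (hc : IsDiscr c) : IsUnit p := by
  have hp : p ≠ 0 := by
    rintro rfl; exact NumberField.discr_ne_zero K (by rw [h]; ring)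
  have hpK : (p : K) ≠ 0 := by exact_mod_cast hp
  obtain ⟨e, he⟩ := hc.exists_four_mul
  have hsq : (s : K) * s = (p : K) ^ 2 * c := by
    rw [hs.coe_sq, h]; simp
  have heK : (c : K) * (c - 1) = 4 * e := by exact_mod_cast he
  set θ : K := ((c : K) + s / p) / 2 with hθ
  have hroot : θ ^ 2 - c * θ + e = 0 := by
    have : (s / p : K) ^ 2 = c := by
      rw [div_pow, _root_.pow_two (s : K), hsq]; field_simp
    rw [hθ]
    linear_combination (1 / 4 : K) * this - (1 / 4 : K) * heK
  have hint : IsIntegral ℤ θ := by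
    refine ⟨Polynomial.X ^ 2 - Polynomial.C c * Polynomial.X + Polynomial.C e, ?_, ?_⟩
    · monicity!
    · rw [Polynomial.eval₂_add, Polynomial.eval₂_sub, Polynomial.eval₂_mul, Polynomial.eval₂_pow,
        Polynomial.eval₂_X, Polynomial.eval₂_C, Polynomial.eval₂_C]
      simpa using hroot
  obtain ⟨y, hy⟩ : ∃ y : 𝓞 K, (y : K) = θ := ⟨⟨θ, hint⟩, rfl⟩
  obtain ⟨k, hk⟩ := hs.exists_sub_conj y
  have hk' : θ - τ θ = k * s := by
    have := congrArg (algebraMap (𝓞 K) K) hk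
    rw [map_sub, map_mul, map_intCast] at this
    rw [← hy]
    exact this
  have e1 : θ - τ θ = s / p := by
    rw [hθ, map_div₀, map_add, map_div₀, hs.coe_conj, map_intCast, map_intCast, map_ofNat]
    ring
  have e2 : (s : K) / p = k * s := by
    rw [← e1, hk']
  have e3 : (p : K) * k = 1 := by
    have := hs.ne_zero
    field_simp at e2
    linear_combination -e2
  exact IsUnit.of_mul_eq_one k (by exact_mod_cast e3)

end IsSqrtDiscr

end QuadraticField

/-! ### Ideals of a quadratic field and the narrow class group -/

/-- If `c a⁻¹ = b c⁻¹`, then `a` and `b` differ by a square. -/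
theorem modSquares_eq_of_mul_inv_eq {G : Type*} [CommGroup G] {a b c : G}
    (h : c * a⁻¹ = b * c⁻¹) : (a : ModSquares G) = b := by
  rw [QuotientGroup.eq]
  refine ⟨a⁻¹ * c, ?_⟩
  have hb : b = c * a⁻¹ * c := by rw [h]; group
  rw [powMonoidHom_apply, hb, pow_two]
  simp only [mul_comm, mul_left_comm]

section NarrowClass

variable {K : Type*} [Field K] [NumberField K]

theorem narrowClass_mul (I J : (Ideal (𝓞 K))⁰) :
    narrowClass (I * J) = narrowClass I * narrowClass J := by
  rw [narrowClass, map_mul]; rfl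

theorem narrowClass_one : narrowClass (1 : (Ideal (𝓞 K))⁰) = 1 := by
  rw [narrowClass, map_one]; rfl

/-- The non-zero principal ideal generated by `x`. -/
noncomputable def principalIdeal (x : 𝓞 K) (hx : x ≠ 0) : (Ideal (𝓞 K))⁰ :=
  ⟨Ideal.span {x}, mem_nonZeroDivisors_of_ne_zero (by simpa using hx)⟩

theorem narrowClass_principalIdeal {x : 𝓞 K} (hx : x ≠ 0)
    (hpos : ∀ φ : K →+* ℝ, 0 < φ (x : K)) : narrowClass (principalIdeal x hx) = 1 := by
  rw [narrowClass, QuotientGroup.eq_one_iff]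
  have hx' : (x : K) ≠ 0 := by simpa using hx
  refine ⟨Units.mk0 (x : K) hx', fun φ => hpos φ, ?_⟩
  rw [toPrincipalIdeal_eq_iff]
  simp [principalIdeal, FractionalIdeal.coeIdeal_span_singleton]

theorem exists_of_narrowClass_eq {I J : (Ideal (𝓞 K))⁰} (h : narrowClass I = narrowClass J) :
    ∃ z : K, (∀ φ : K →+* ℝ, 0 < φ z) ∧
      (Ideal.absNorm (J : Ideal (𝓞 K)) : ℚ) =
        |Algebra.norm ℚ z| * Ideal.absNorm (I : Ideal (𝓞 K)) := by
  rw [narrowClass, narrowClass, QuotientGroup.eq] at h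
  obtain ⟨z, hz, h⟩ := h
  refine ⟨z, hz, ?_⟩
  have h1 : FractionalIdeal.mk0 K I * toPrincipalIdeal (𝓞 K) K z = FractionalIdeal.mk0 K J := by
    rw [h]; group
  have h2 := congrArg (fun x : (FractionalIdeal (𝓞 K)⁰ K)ˣ =>
    FractionalIdeal.absNorm (x : FractionalIdeal (𝓞 K)⁰ K)) h1
  simp only [Units.val_mul, map_mul, coe_toPrincipalIdeal, FractionalIdeal.coe_mk0,
    FractionalIdeal.coeIdeal_absNorm, FractionalIdeal.absNorm_span_singleton] at h2
  rw [← h2, mul_comm]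

variable (hK : Module.finrank ℚ K = 2) {τ : K ≃ₐ[ℚ] K} (hτ : τ ≠ AlgEquiv.refl)
include hK hτ

theorem ringHom_add_conj (φ : K →+* ℝ) (z : K) : φ z + φ (τ z) = (Algebra.trace ℚ K z : ℝ) := by
  rw [← map_add, ← algebraMap_trace_eq hK hτ]
  simp

theorem ringHom_mul_conj (φ : K →+* ℝ) (z : K) : φ z * φ (τ z) = (Algebra.norm ℚ z : ℝ) := by
  rw [← map_mul, ← algebraMap_norm_eq hK hτ]
  simp

/-- In a quadratic field, an element of positive norm is totally positive up to sign: its sign at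
each real place is that of its trace. -/
theorem totallyPositive_or_neg {z : K} (hz : 0 < Algebra.norm ℚ z) :
    (∀ φ : K →+* ℝ, 0 < φ z) ∨ ∀ φ : K →+* ℝ, 0 < φ (-z) := by
  have hz' : (0 : ℝ) < Algebra.norm ℚ z := by exact_mod_cast hz
  rcases le_total (0 : ℝ) (Algebra.trace ℚ K z) with h | h
  · left
    intro φ
    have h1 := ringHom_add_conj hK hτ φ z
    have h2 := ringHom_mul_conj hK hτ φ z
    by_contra! hn
    nlinarith
  · right
    intro φ
    have h1 := ringHom_add_conj hK hτ φ z
    have h2 := ringHom_mul_conj hK hτ φ z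
    rw [map_neg]
    by_contra! hn
    nlinarith

theorem exists_real_embedding (hreal : 0 < NumberField.discr K) : Nonempty (K →+* ℝ) := by
  obtain ⟨s, hs⟩ := exists_isSqrtDiscr hK hτ
  obtain ⟨φ⟩ : Nonempty (K →+* ℂ) := inferInstance
  have hφs : φ s * φ s = (NumberField.discr K : ℂ) := by
    rw [← map_mul, hs.coe_sq]; simp
  have him : (φ s).im = 0 := by
    have h1 := congrArg Complex.re hφs
    have h2 := congrArg Complex.im hφs
    simp at h1 h2
    have hpos : (0 : ℝ) < NumberField.discr K := by exact_mod_cast hreal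
    by_contra h
    have h3 : (φ s).re = 0 := by
      have : (φ s).re * (φ s).im = 0 := by linarith
      exact (mul_eq_zero.1 this).resolve_right h
    rw [h3] at h1
    nlinarith [mul_self_nonneg (φ s).im]
  have hreal' : NumberField.ComplexEmbedding.IsReal φ := by
    rw [NumberField.ComplexEmbedding.isReal_iff]
    ext x
    obtain ⟨p, q, rfl⟩ := hs.exists_rat_add hK hτ x
    simp [NumberField.ComplexEmbedding.conjugate_coe_eq, Complex.conj_eq_iff_im.2 him]
  exact ⟨hreal'.embedding⟩

theorem norm_pos_of_totallyPositive (hreal : 0 < NumberField.discr K) {z : K}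
    (hz : ∀ φ : K →+* ℝ, 0 < φ z) : 0 < Algebra.norm ℚ z := by
  obtain ⟨φ⟩ := exists_real_embedding hK hτ hreal
  have h := ringHom_mul_conj hK hτ φ z
  have : (0 : ℝ) < Algebra.norm ℚ z := by
    rw [← h]
    exact mul_pos (hz φ) (hz (φ.comp (τ : K →+* K)))
  exact_mod_cast this

theorem narrowClass_principalIdeal_of_norm_pos {x : 𝓞 K} (hx : x ≠ 0)
    (hpos : 0 < Algebra.norm ℚ (x : K)) : narrowClass (principalIdeal x hx) = 1 := by
  rcases totallyPositive_or_neg hK hτ hpos with h | h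
  · exact narrowClass_principalIdeal hx h
  · have : principalIdeal x hx = principalIdeal (-x) (neg_ne_zero.2 hx) :=
      Subtype.ext (by simp [principalIdeal, Ideal.span_singleton_neg])
    rw [this]
    exact narrowClass_principalIdeal _ fun φ => by simpa using h φ

omit hK hτ in
theorem absNorm_map_conj (I : Ideal (𝓞 K)) :
    Ideal.absNorm (I.map (conjInt τ)) = Ideal.absNorm I := by
  let e : 𝓞 K ≃ₐ[ℤ] 𝓞 K := AlgEquiv.ofRingEquiv (f := conjInt τ) (by simp)
  have h := Ideal.relNorm_map_algEquiv (R := ℤ) e I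
  have h' := congrArg Ideal.absNorm h
  rw [Ideal.absNorm_relNorm, Ideal.absNorm_relNorm] at h'
  exact h'

/-- The product of an ideal and its conjugate is generated by the absolute norm. The norm
lies in the ideal generated by the norms of elements, which is contained in the product, and both
sides have the same index. -/
theorem mul_map_conj (I : Ideal (𝓞 K)) :
    I * I.map (conjInt τ) = Ideal.span {(Ideal.absNorm I : 𝓞 K)} := by
  by_cases hI : I = ⊥
  · subst hI; simp
  have hle : Ideal.span {(Ideal.absNorm I : 𝓞 K)} ≤ I * I.map (conjInt τ) := by
    have h1 := Ideal.map_relNorm ℤ I (algebraMap ℤ (𝓞 K))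
    rw [Ideal.relNorm_int, Ideal.map_span, Set.image_singleton] at h1
    have h2 : algebraMap ℤ (𝓞 K) (Ideal.absNorm I : ℤ) = (Ideal.absNorm I : 𝓞 K) := by simp
    rw [← h2, h1, Ideal.span_le]
    rintro _ ⟨x, hx, rfl⟩
    have h3 : algebraMap ℤ (𝓞 K) (Algebra.intNorm ℤ (𝓞 K) x) = x * conjInt τ x := by
      rw [Algebra.intNorm_eq_norm, ← intNorm_eq hK hτ]; simp
    simp only [Function.comp_apply, SetLike.mem_coe]
    rw [h3]
    exact Ideal.mul_mem_mul hx (Ideal.mem_map_of_mem _ hx)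
  obtain ⟨C, hC⟩ := Ideal.dvd_iff_le.2 hle
  have hn : Ideal.absNorm I ≠ 0 := fun h => hI (Ideal.absNorm_eq_zero_iff.1 h)
  have h1 := congrArg Ideal.absNorm hC
  rw [map_mul, map_mul, absNorm_map_conj, Ideal.absNorm_span_natCast,
    NumberField.RingOfIntegers.rank, hK, pow_two] at h1
  have h2 : Ideal.absNorm C = 1 := by
    have : 0 < Ideal.absNorm I * Ideal.absNorm I := by positivity
    exact Nat.eq_of_mul_eq_mul_left this (by rw [← h1, mul_one])
  rw [hC, Ideal.absNorm_eq_one_iff.1 h2, Ideal.mul_top]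

omit hK hτ in
theorem map_conj_ne_zero (I : (Ideal (𝓞 K))⁰) :
    (I : Ideal (𝓞 K)).map (conjInt τ) ∈ (Ideal (𝓞 K))⁰ := by
  refine mem_nonZeroDivisors_of_ne_zero fun h => nonZeroDivisors.coe_ne_zero I ?_
  exact (Ideal.map_eq_bot_iff_of_injective (conjInt τ).injective).1 h

/-- The conjugate of a non-zero ideal. -/
noncomputable def conjIdeal (τ : K ≃ₐ[ℚ] K) (I : (Ideal (𝓞 K))⁰) : (Ideal (𝓞 K))⁰ :=
  ⟨(I : Ideal (𝓞 K)).map (conjInt τ), map_conj_ne_zero I⟩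

theorem narrowClass_mul_conjIdeal (I : (Ideal (𝓞 K))⁰) :
    narrowClass I * narrowClass (conjIdeal τ I) = 1 := by
  have hn : (Ideal.absNorm (I : Ideal (𝓞 K)) : 𝓞 K) ≠ 0 := by
    exact_mod_cast Ideal.absNorm_ne_zero_of_nonZeroDivisors I
  have : I * conjIdeal τ I = principalIdeal _ hn := Subtype.ext (mul_map_conj hK hτ _)
  rw [← narrowClass_mul, this]
  refine narrowClass_principalIdeal hn fun φ => ?_
  simpa using Ideal.absNorm_pos_of_nonZeroDivisors I

/-- Two ideals of equal norm are in the same genus: the ideal `C = A + B` satisfies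
`C τ(A) = B τ(C)`, an instance of Hilbert's Theorem 90 for ideals, whence `[C]² = [A][B]`. -/
theorem narrowClass_modSquares_of_absNorm_eq (A B : (Ideal (𝓞 K))⁰)
    (h : Ideal.absNorm (A : Ideal (𝓞 K)) = Ideal.absNorm (B : Ideal (𝓞 K))) :
    (narrowClass A : ModSquares (NarrowClassGroup K)) = narrowClass B := by
  have hC : (A : Ideal (𝓞 K)) ⊔ B ∈ (Ideal (𝓞 K))⁰ := by
    refine mem_nonZeroDivisors_of_ne_zero fun h0 => nonZeroDivisors.coe_ne_zero A ?_
    exact (sup_eq_bot_iff.1 h0).1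
  let C : (Ideal (𝓞 K))⁰ := ⟨_, hC⟩
  have hCA : C * conjIdeal τ A = B * conjIdeal τ C := by
    apply Subtype.ext
    change ((A : Ideal (𝓞 K)) ⊔ B) * (A : Ideal (𝓞 K)).map (conjInt τ) =
      B * ((A : Ideal (𝓞 K)) ⊔ B).map (conjInt τ)
    rw [Ideal.map_sup, Ideal.sup_mul, Ideal.mul_sup, mul_map_conj hK hτ, mul_map_conj hK hτ, h,
      sup_comm]
  have h1 := congrArg narrowClass hCA
  have hinv : ∀ I : (Ideal (𝓞 K))⁰, narrowClass (conjIdeal τ I) = (narrowClass I)⁻¹ := fun I =>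
    eq_inv_of_mul_eq_one_right (narrowClass_mul_conjIdeal hK hτ I)
  rw [narrowClass_mul, narrowClass_mul, hinv, hinv] at h1
  exact modSquares_eq_of_mul_inv_eq h1

/-- Writing `z = x / m` with `x` integral, the ideals `x A` and `m B` have equal norms, and `x` and
`m`, being of positive norm, do not change the narrow class. -/
theorem narrowClass_modSquares_of_norm (A B : (Ideal (𝓞 K))⁰) (z : K)
    (h : (Ideal.absNorm (B : Ideal (𝓞 K)) : ℚ) =
      Algebra.norm ℚ z * Ideal.absNorm (A : Ideal (𝓞 K))) :
    (narrowClass A : ModSquares (NarrowClassGroup K)) = narrowClass B := by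
  have hA : (0 : ℚ) < Ideal.absNorm (A : Ideal (𝓞 K)) := by
    exact_mod_cast Ideal.absNorm_pos_of_nonZeroDivisors A
  have hB : (0 : ℚ) < Ideal.absNorm (B : Ideal (𝓞 K)) := by
    exact_mod_cast Ideal.absNorm_pos_of_nonZeroDivisors B
  have hz : 0 < Algebra.norm ℚ z := pos_of_mul_pos_left (h ▸ hB) hA.le
  have hz0 : z ≠ 0 := by rintro rfl; simp at hz
  obtain ⟨m, hm, hint⟩ := IsAlgebraic.exists_integral_multiple
    ((IsFractionRing.isAlgebraic_iff ℤ ℚ K).2 (Algebra.IsAlgebraic.isAlgebraic (R := ℚ) z))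
  obtain ⟨x, hx⟩ : ∃ x : 𝓞 K, (x : K) = m * z := ⟨⟨m • z, hint⟩, by simp⟩
  have hmK : (m : K) ≠ 0 := by exact_mod_cast hm
  have hm' : (m : 𝓞 K) ≠ 0 := by exact_mod_cast hm
  have hx0 : x ≠ 0 := by
    rintro rfl
    simp [hmK, hz0] at hx
  have hNm : Algebra.norm ℚ (m : K) = (m : ℚ) ^ 2 := by
    have := Algebra.norm_algebraMap (R := ℚ) (S := K) (m : ℚ)
    rwa [hK, map_intCast] at this
  have hm2 : (0 : ℚ) < (m : ℚ) ^ 2 := by positivity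
  have hNx : Algebra.norm ℚ (x : K) = (m : ℚ) ^ 2 * Algebra.norm ℚ z := by
    rw [hx, map_mul, hNm]
  have h1 : narrowClass (principalIdeal x hx0) = 1 :=
    narrowClass_principalIdeal_of_norm_pos hK hτ hx0 (by rw [hNx]; positivity)
  have h2 : narrowClass (principalIdeal (m : 𝓞 K) hm') = 1 :=
    narrowClass_principalIdeal_of_norm_pos hK hτ hm' (by simpa [hNm] using hm2)
  have habs : ∀ (y : 𝓞 K) (hy : y ≠ 0) (q : ℚ), 0 < q → Algebra.norm ℚ (y : K) = q →
      (Ideal.absNorm (principalIdeal y hy : Ideal (𝓞 K)) : ℚ) = q := by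
    intro y hy q hq hyq
    rw [principalIdeal, Ideal.absNorm_span_singleton, Nat.cast_natAbs, Int.cast_abs,
      Algebra.coe_norm_int, hyq, abs_of_pos hq]
  have key := narrowClass_modSquares_of_absNorm_eq hK hτ (principalIdeal x hx0 * A)
    (principalIdeal (m : 𝓞 K) hm' * B) (by
      have : ((Ideal.absNorm ((principalIdeal x hx0 * A : (Ideal (𝓞 K))⁰) : Ideal (𝓞 K)) : ℕ) : ℚ) =
          Ideal.absNorm ((principalIdeal (m : 𝓞 K) hm' * B : (Ideal (𝓞 K))⁰) : Ideal (𝓞 K)) := by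
        rw [Submonoid.coe_mul, Submonoid.coe_mul, map_mul, map_mul, Nat.cast_mul, Nat.cast_mul,
          habs x hx0 _ (by positivity) hNx, habs _ hm' _ hm2 (by simpa using hNm), h]
        ring
      exact_mod_cast this)
  have hA' : narrowClass (principalIdeal x hx0 * A) = narrowClass A := by
    rw [narrowClass_mul, h1]; exact one_mul (M := NarrowClassGroup K) _
  have hB' : narrowClass (principalIdeal (m : 𝓞 K) hm' * B) = narrowClass B := by
    rw [narrowClass_mul, h2]; exact one_mul (M := NarrowClassGroup K) _
  rwa [hA', hB'] at key

/-- Every narrow class contains an integral ideal of norm prime to a given integer `n`: for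
`A = τ(I)`, choose a totally positive `y ∈ A` with `A = n A + (y)`, and let `J = y A⁻¹`. -/
theorem exists_narrowClass_eq_coprime (hreal : 0 < NumberField.discr K) (I : (Ideal (𝓞 K))⁰)
    {n : ℕ} (hn : n ≠ 0) :
    ∃ J : (Ideal (𝓞 K))⁰, narrowClass J = narrowClass I ∧
      (Ideal.absNorm (J : Ideal (𝓞 K))).Coprime n := by
  set A : Ideal (𝓞 K) := (conjIdeal τ I : Ideal (𝓞 K)) with hA
  have hA0 : A ≠ 0 := nonZeroDivisors.coe_ne_zero _
  set c : ℕ := n * Ideal.absNorm A with hc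
  have hAn : Ideal.absNorm A ≠ 0 := Ideal.absNorm_ne_zero_of_nonZeroDivisors _
  have hcmem : (c : 𝓞 K) ∈ A * Ideal.span {(n : 𝓞 K)} := by
    rw [hc, Nat.cast_mul, mul_comm (n : 𝓞 K)]
    exact Ideal.mul_mem_mul (Ideal.absNorm_mem A) (Ideal.mem_span_singleton_self _)
  have hspan : Ideal.span {(n : 𝓞 K)} ≠ ⊥ := by simpa using hn
  obtain ⟨x, hx⟩ := IsDedekindDomain.exists_sup_span_eq (Ideal.mul_le_left (I := A)
    (J := Ideal.span {(n : 𝓞 K)})) (mul_ne_zero hA0 hspan)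
  -- adding a large multiple of `c` makes `x` totally positive
  obtain ⟨b, hb⟩ := Set.Finite.bddAbove (Set.finite_range fun φ : K →+* ℝ => -φ (x : K))
  obtain ⟨k, hk⟩ := exists_nat_gt b
  set y : 𝓞 K := x + k * c with hy
  have hypos : ∀ φ : K →+* ℝ, 0 < φ (y : K) := by
    intro φ
    have h1 : -φ (x : K) ≤ b := hb ⟨φ, rfl⟩
    have h2 : φ (y : K) = φ x + k * c := by simp [hy]
    have h3 : (1 : ℝ) ≤ c := by
      exact_mod_cast Nat.one_le_iff_ne_zero.2 (mul_ne_zero hn hAn)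
    have h4 : (k : ℝ) * 1 ≤ k * c := mul_le_mul_of_nonneg_left h3 (Nat.cast_nonneg k)
    rw [h2]; linarith
  have hysup : A * Ideal.span {(n : 𝓞 K)} ⊔ Ideal.span {y} = A := by
    apply le_antisymm
    · refine sup_le Ideal.mul_le_left ?_
      rw [Ideal.span_singleton_le_iff_mem]
      refine A.add_mem ?_ (A.mul_mem_left _ (Ideal.mul_le_left hcmem))
      rw [← hx]; exact Ideal.mem_sup_right (Ideal.mem_span_singleton_self x)
    · refine hx.ge.trans ?_
      refine sup_le le_sup_left ?_
      rw [Ideal.span_singleton_le_iff_mem]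
      have : x = -(k * c : 𝓞 K) + y := by rw [hy]; ring
      rw [this]
      exact Ideal.add_mem _ (Ideal.mem_sup_left ((Ideal.neg_mem_iff _).2
        (Ideal.mul_mem_left _ _ hcmem))) (Ideal.mem_sup_right (Ideal.mem_span_singleton_self y))
  obtain ⟨J, hJ⟩ := Ideal.dvd_iff_le.2 (le_sup_right.trans hysup.le : Ideal.span {y} ≤ A)
  have hcop : Ideal.span {(n : 𝓞 K)} ⊔ J = ⊤ := by
    rw [hJ, ← Ideal.mul_sup] at hysup
    exact mul_left_cancel₀ hA0 (hysup.trans (Ideal.mul_top A).symm)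
  have hJ0 : J ∈ (Ideal (𝓞 K))⁰ := by
    refine mem_nonZeroDivisors_of_ne_zero fun h => ?_
    rw [h, mul_zero, Ideal.zero_eq_bot, Ideal.span_singleton_eq_bot] at hJ
    obtain ⟨φ⟩ := exists_real_embedding hK hτ hreal
    have := hypos φ
    rw [hJ] at this
    simp at this
  have hy0 : y ≠ 0 := by
    rintro h
    obtain ⟨φ⟩ := exists_real_embedding hK hτ hreal
    have := hypos φ
    rw [h] at this
    simp at this
  refine ⟨⟨J, hJ0⟩, ?_, ?_⟩
  · have h1 : principalIdeal y hy0 = conjIdeal τ I * ⟨J, hJ0⟩ := Subtype.ext hJ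
    have h2 := narrowClass_principalIdeal hy0 hypos
    rw [h1, narrowClass_mul] at h2
    exact (eq_inv_of_mul_eq_one_right h2).trans
      (eq_inv_of_mul_eq_one_left (narrowClass_mul_conjIdeal hK hτ I)).symm
  · refine Nat.Coprime.symm (Nat.coprime_of_dvd fun p hp hpn hpJ => ?_)
    obtain ⟨P, hP, hPp, hPJ⟩ := Ideal.exists_isMaximal_dvd_of_dvd_absNorm' hp J hpJ
    refine hP.ne_top (top_le_iff.1 ?_)
    rw [← hcop]
    refine sup_le ?_ (Ideal.dvd_iff_le.1 hPJ)
    rw [Ideal.span_singleton_le_iff_mem]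
    have hpP : ((p : ℤ) : 𝓞 K) ∈ P := by
      have : (p : ℤ) ∈ P.under ℤ := by rw [hPp]; exact Ideal.mem_span_singleton_self _
      simpa [Ideal.under_def] using this
    obtain ⟨q, rfl⟩ := hpn
    rw [Nat.cast_mul, mul_comm]
    exact P.mul_mem_left _ (by exact_mod_cast hpP)

end NarrowClass

/-! ### Splitting of primes in `K(√d)` -/

section Splitting

variable {K L : Type*} [Field K] [NumberField K] [Field L] [NumberField L] [Algebra K L]

theorem ncard_primesOver_dvd_finrank [IsGalois K L] (𝔭 : Ideal (𝓞 K)) [𝔭.IsPrime] :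
    (𝔭.primesOver (𝓞 L)).ncard ∣ Module.finrank K L := by
  have h := Ideal.ncard_primesOver_mul_ramificationIdxIn_mul_inertiaDegIn 𝔭 (𝓞 L) Gal(L/K)
  rw [IsGalois.card_aut_eq_finrank] at h
  exact Dvd.intro _ h

/-- If a prime splits completely, the residue fields do not grow. -/
theorem exists_sub_mem_of_splitsCompletely [IsGalois K L] (𝔭 : Ideal (𝓞 K)) [𝔭.IsMaximal]
    (h : SplitsCompletely 𝔭 L) (P : Ideal (𝓞 L)) [P.IsPrime] [P.LiesOver 𝔭] (x : 𝓞 L) :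
    ∃ a : 𝓞 K, x - algebraMap (𝓞 K) (𝓞 L) a ∈ P := by
  have hP : P.IsMaximal := Ideal.IsMaximal.of_liesOver_isMaximal P 𝔭
  have h1 := Ideal.ncard_primesOver_mul_ramificationIdxIn_mul_inertiaDegIn 𝔭 (𝓞 L) Gal(L/K)
  rw [IsGalois.card_aut_eq_finrank, h] at h1
  have h2 : 𝔭.inertiaDegIn (𝓞 L) = 1 := by
    have : 0 < Module.finrank K L := Module.finrank_pos
    have h3 := Nat.eq_of_mul_eq_mul_left this (h1.trans (mul_one _).symm)
    exact Nat.dvd_one.1 (Dvd.intro_left _ h3)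
  rw [Ideal.inertiaDegIn_eq_inertiaDeg 𝔭 P Gal(L/K), Ideal.inertiaDeg_eq_of_isMaximal 𝔭 P] at h2
  let _ : Field (𝓞 K ⧸ 𝔭) := Ideal.Quotient.field 𝔭
  obtain ⟨a, ha⟩ := (finrank_eq_one_iff_of_nonzero' (K := 𝓞 K ⧸ 𝔭) (1 : 𝓞 L ⧸ P) one_ne_zero).1 h2
    (Ideal.Quotient.mk P x)
  obtain ⟨a, rfl⟩ := Ideal.Quotient.mk_surjective a
  refine ⟨a, ?_⟩
  rw [← Ideal.Quotient.eq, ← ha, Algebra.smul_def, mul_one]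
  rfl

/-- Let `L = K(√d)`, with `d` a discriminant. A prime of `K` prime to `d` splits completely in `L` if
and only if the minimal polynomial of `(d + √d)/2` has a root modulo this prime. -/
theorem splitsCompletely_iff_exists_root {r : L} {d e : ℤ} (hr : r * r = d)
    (he : d * (d - 1) = 4 * e) (hL : IntermediateField.adjoin K {r} = ⊤)
    (𝔭 : Ideal (𝓞 K)) [h𝔭 : 𝔭.IsMaximal] (hd : (d : 𝓞 K) ∉ 𝔭) :
    SplitsCompletely 𝔭 L ↔ ∃ a : 𝓞 K, a * a - d * a + e ∈ 𝔭 := by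
  have heL : (d : L) * (d - 1) = 4 * e := by exact_mod_cast he
  have heK : (d : K) * (d - 1) = 4 * e := by exact_mod_cast he
  by_cases hrK : r ∈ (⊥ : IntermediateField K L)
  · have hfin : Module.finrank K L = 1 := by
      rw [← IntermediateField.finrank_top', ← hL, IntermediateField.adjoin_simple_eq_bot_iff.2 hrK,
        IntermediateField.finrank_bot]
    have hgal : IsGalois K L := by
      rw [← isGalois_iff_isGalois_top, ← hL, IntermediateField.adjoin_simple_eq_bot_iff.2 hrK]
      infer_instance
    refine iff_of_true ?_ ?_
    · rw [SplitsCompletely, hfin]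
      exact Nat.dvd_one.1 (hfin ▸ ncard_primesOver_dvd_finrank 𝔭)
    · obtain ⟨t, rfl⟩ := IntermediateField.mem_bot.1 hrK
      have ht : t * t = d := (algebraMap K L).injective (by simpa using hr)
      have hroot : (((d : K) + t) / 2) ^ 2 - d * ((d + t) / 2) + e = 0 := by
        linear_combination (1 / 4 : K) * ht - (1 / 4 : K) * heK
      have hint : IsIntegral ℤ (((d : K) + t) / 2) := by
        refine ⟨Polynomial.X ^ 2 - Polynomial.C d * Polynomial.X + Polynomial.C e, ?_, ?_⟩
        · monicity!
        · rw [Polynomial.eval₂_add, Polynomial.eval₂_sub, Polynomial.eval₂_mul,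
            Polynomial.eval₂_pow, Polynomial.eval₂_X, Polynomial.eval₂_C, Polynomial.eval₂_C]
          simpa using hroot
      obtain ⟨a, ha⟩ : ∃ a : 𝓞 K, algebraMap (𝓞 K) K a = (d + t) / 2 := ⟨⟨_, hint⟩, rfl⟩
      refine ⟨a, ?_⟩
      have : a * a - d * a + e = 0 := by
        rw [← NumberField.RingOfIntegers.coe_eq_zero_iff, map_add, map_sub, map_mul, map_mul,
          map_intCast, map_intCast, ha]
        linear_combination hroot
      rw [this]
      exact 𝔭.zero_mem
  · have hint_r : IsIntegral K r := Algebra.IsIntegral.isIntegral r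
    have hfin : Module.finrank K L = 2 := by
      rw [← IntermediateField.finrank_top', ← hL, IntermediateField.adjoin.finrank hint_r]
      apply le_antisymm
      · have hdvd : minpoly K r ∣ Polynomial.X ^ 2 - Polynomial.C (d : K) :=
          minpoly.dvd K r (by simp [pow_two, hr])
        have := Polynomial.natDegree_le_of_dvd hdvd (Polynomial.X_pow_sub_C_ne_zero two_pos _)
        rwa [Polynomial.natDegree_X_pow_sub_C] at this
      · rw [minpoly.two_le_natDegree_iff hint_r]
        exact fun h => hrK (IntermediateField.mem_bot.2 h)
    have : Algebra.IsQuadraticExtension K L := ⟨hfin⟩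
    have hgal : IsGalois K L := inferInstance
    -- the non-trivial automorphism changes the sign of `r`
    obtain ⟨σ, hσ⟩ : ∃ σ : L ≃ₐ[K] L, σ r ≠ r := by
      by_contra! h
      exact hrK ((IsGalois.mem_bot_iff_fixed r).2 h)
    have hσr : σ r = -r := by
      have h1 : (σ r - r) * (σ r + r) = 0 := by
        have : σ r * σ r = r * r := by rw [← map_mul, hr, map_intCast]
        linear_combination this
      exact eq_neg_of_add_eq_zero_left ((mul_eq_zero.1 h1).resolve_left (sub_ne_zero.2 hσ))
    have hintθ : ∀ u : L, u * u = d → IsIntegral ℤ (((d : L) + u) / 2) := by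
      intro u hu
      refine ⟨Polynomial.X ^ 2 - Polynomial.C d * Polynomial.X + Polynomial.C e, ?_, ?_⟩
      · monicity!
      · rw [Polynomial.eval₂_add, Polynomial.eval₂_sub, Polynomial.eval₂_mul,
          Polynomial.eval₂_pow, Polynomial.eval₂_X, Polynomial.eval₂_C, Polynomial.eval₂_C]
        have : (((d : L) + u) / 2) ^ 2 - d * ((d + u) / 2) + e = 0 := by
          linear_combination (1 / 4 : L) * hu - (1 / 4 : L) * heL
        simpa using this
    obtain ⟨θ, hθ⟩ : ∃ θ : 𝓞 L, (θ : L) = (d + r) / 2 := ⟨⟨_, hintθ r hr⟩, rfl⟩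
    obtain ⟨θ', hθ'⟩ : ∃ θ' : 𝓞 L, (θ' : L) = (d + -r) / 2 :=
      ⟨⟨_, hintθ (-r) (by rw [neg_mul_neg, hr])⟩, rfl⟩
    have hadd : θ + θ' = d := by
      apply NumberField.RingOfIntegers.ext
      simp only [map_add, hθ, hθ', map_intCast]; ring
    have hmul : θ * θ' = e := by
      apply NumberField.RingOfIntegers.ext
      simp only [map_mul, hθ, hθ', map_intCast]
      linear_combination (-1 / 4 : L) * hr + (1 / 4 : L) * heL
    have hfac : ∀ a : 𝓞 K, algebraMap (𝓞 K) (𝓞 L) (a * a - d * a + e) =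
        (θ - algebraMap (𝓞 K) (𝓞 L) a) * (θ' - algebraMap (𝓞 K) (𝓞 L) a) := by
      intro a
      simp only [map_add, map_sub, map_mul, map_intCast, ← hadd, ← hmul]
      ring
    constructor
    · intro h
      obtain ⟨⟨P, hP, hPover⟩⟩ : Nonempty (𝔭.primesOver (𝓞 L)) := inferInstance
      obtain ⟨a, ha⟩ := exists_sub_mem_of_splitsCompletely 𝔭 h P θ
      refine ⟨a, ?_⟩
      rw [Ideal.mem_of_liesOver P 𝔭, hfac]
      exact P.mul_mem_right _ ha
    · rintro ⟨a, ha⟩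
      rw [SplitsCompletely, hfin]
      have hdvd := ncard_primesOver_dvd_finrank (L := L) 𝔭
      rw [hfin, Nat.dvd_prime Nat.prime_two] at hdvd
      refine hdvd.resolve_left fun hone => hd ?_
      obtain ⟨P, hP⟩ := Set.ncard_eq_one.1 hone
      obtain ⟨hPprime, hPover⟩ : P ∈ 𝔭.primesOver (𝓞 L) := by rw [hP]; rfl
      let σO : 𝓞 L ≃ₐ[𝓞 K] 𝓞 L := NumberField.RingOfIntegers.mapAlgEquiv σ
      have hσO : ∀ x : 𝓞 L, ((σO x : 𝓞 L) : L) = σ x := fun x => rfl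
      have hσθ : σO θ = θ' := by
        apply NumberField.RingOfIntegers.ext
        rw [hσO, hθ, hθ', map_div₀, map_add, hσr, map_intCast, map_ofNat]
      have hσθ' : σO θ' = θ := by
        apply NumberField.RingOfIntegers.ext
        rw [hσO, hθ, hθ', map_div₀, map_add, map_neg, hσr, map_intCast, map_ofNat, neg_neg]
      -- the only prime over `𝔭` is stable under conjugation
      have hstable : P.comap σO = P := by
        have : P.comap σO ∈ 𝔭.primesOver (𝓞 L) := ⟨inferInstance, inferInstance⟩
        rw [hP] at this
        exact this
      have hmem : (θ - algebraMap (𝓞 K) (𝓞 L) a) * (θ' - algebraMap (𝓞 K) (𝓞 L) a) ∈ P := by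
        rw [← hfac, ← Ideal.mem_of_liesOver P 𝔭]; exact ha
      have h1 : θ - algebraMap (𝓞 K) (𝓞 L) a ∈ P ∧ θ' - algebraMap (𝓞 K) (𝓞 L) a ∈ P := by
        rcases hPprime.mem_or_mem hmem with h | h
        · refine ⟨h, ?_⟩
          rw [← hstable, Ideal.mem_comap, map_sub, hσθ', AlgEquiv.commutes]
          exact h
        · refine ⟨?_, h⟩
          rw [← hstable, Ideal.mem_comap, map_sub, hσθ, AlgEquiv.commutes]
          exact h
      have h2 : θ - θ' ∈ P := by
        have := P.sub_mem h1.1 h1.2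
        rwa [sub_sub_sub_cancel_right] at this
      rw [Ideal.mem_of_liesOver P 𝔭, map_intCast]
      have h3 : (d : 𝓞 L) = (θ - θ') * (θ - θ') := by
        apply NumberField.RingOfIntegers.ext
        simp only [map_mul, map_sub, hθ, hθ', map_intCast]
        linear_combination -hr
      rw [h3]
      exact P.mul_mem_right _ h2

end Splitting

/-! ### Quadratic characters and residue fields -/

section Characters

open NumberTheorySymbols

theorem jacobiSym_eq_of_one_mod_four {d : ℤ} (hd : d % 4 = 1) {n : ℕ} (hn : Odd n) :
    J(d | n) = J(n | d.natAbs) := by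
  rcases Int.natAbs_eq d with h | h
  · have h1 : d.natAbs % 4 = 1 := by omega
    nth_rewrite 1 [h]
    exact jacobiSym.quadratic_reciprocity_one_mod_four h1 hn
  · have h1 : d.natAbs % 4 = 3 := by omega
    nth_rewrite 1 [h]
    rw [jacobiSym.neg _ hn]
    rcases Nat.odd_mod_four_iff.1 (Nat.odd_iff.1 hn) with h2 | h2
    · rw [ZMod.χ₄_nat_one_mod_four h2, one_mul,
        jacobiSym.quadratic_reciprocity_one_mod_four' (Nat.odd_iff.2 (by omega)) h2]
    · rw [ZMod.χ₄_nat_three_mod_four h2,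
        jacobiSym.quadratic_reciprocity_three_mod_four h1 h2]
      ring

variable {d : ℤ} {χ : DirichletCharacter ℤ d.natAbs}

theorem quadraticCharacter_sq {n : ℕ} (h : n.Coprime d.natAbs) :
    χ (n : ZMod d.natAbs) * χ (n : ZMod d.natAbs) = 1 := by
  have h1 : IsUnit (χ (n : ZMod d.natAbs)) := ((ZMod.isUnit_iff_coprime n d.natAbs).2 h).map χ
  rcases Int.isUnit_iff.1 h1 with h | h <;> rw [h] <;> norm_num

theorem quadraticCharacter_two (hχ : IsQuadraticCharacterOf d χ) (hd : d % 4 = 1) :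
    χ ((2 : ℕ) : ZMod d.natAbs) = 1 ↔ d % 8 = 1 := by
  have hodd : Odd (2 + d.natAbs) := Nat.odd_iff.2 (by omega)
  have h1 : ((2 : ℕ) : ZMod d.natAbs) = ((2 + d.natAbs : ℕ) : ZMod d.natAbs) := by simp
  have h2 : J(((2 + d.natAbs : ℕ) : ℤ) | d.natAbs) = J(2 | d.natAbs) :=
    jacobiSym.mod_left' (by rw [Nat.cast_add, Int.add_emod_right]; rfl)
  rw [h1, hχ _ hodd, jacobiSym_eq_of_one_mod_four hd hodd, h2,
    jacobiSym.at_two (Nat.odd_iff.2 (by omega)), ZMod.χ₈_nat_eq_if_mod_eight]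
  have h3 : ¬ d.natAbs % 2 = 0 := by omega
  rw [if_neg h3]
  split_ifs with h4
  · simp only [true_iff]; omega
  · simp only [false_iff]; omega

variable {F : Type*} [Field F] [Finite F] {p : ℕ} [Fact p.Prime] [CharP F p]

omit [Finite F] [Fact p.Prime] in
/-- In odd characteristic, `X² - dX + d(d-1)/4` has a root if and only if its discriminant `d` is a
square. -/
theorem exists_root_iff_isSquare {e : ℤ} (he : d * (d - 1) = 4 * e) (hp : p ≠ 2) :
    (∃ a : F, a * a - d * a + e = 0) ↔ IsSquare (d : F) := by
  have h2 : (2 : F) ≠ 0 := Ring.two_ne_zero (by rwa [ringChar.eq F p])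
  have heF : (d : F) * (d - 1) = 4 * e := by exact_mod_cast congrArg (Int.cast : ℤ → F) he
  constructor
  · rintro ⟨a, ha⟩
    exact ⟨2 * a - d, by linear_combination (-4) * ha - heF⟩
  · rintro ⟨w, hw⟩
    refine ⟨(d + w) / 2, ?_⟩
    field_simp
    linear_combination -hw - heF

/-- An integral quadratic polynomial of discriminant `d` splits over the field with `p²` elements. -/
theorem exists_root_of_card_eq_sq {e : ℤ} (he : d * (d - 1) = 4 * e) (hF : Nat.card F = p ^ 2)
    (hd : (d : F) ≠ 0) : ∃ a : F, a * a - d * a + e = 0 := by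
  have := Fintype.ofFinite F
  have hpp : p.Prime := Fact.out
  rw [Nat.card_eq_fintype_card] at hF
  by_cases hp : p = 2
  · subst hp
    have hdodd : (d : F) = 1 := by
      rcases Int.even_or_odd d with h | h
      · exact absurd ((CharP.intCast_eq_zero_iff F 2 d).2 h.two_dvd) hd
      · obtain ⟨k, rfl⟩ := h
        push_cast
        rw [CharTwo.two_eq_zero]; ring
    rcases Int.even_or_odd e with h | h
    · exact ⟨0, by rw [(CharP.intCast_eq_zero_iff F 2 e).2 h.two_dvd]; ring⟩
    · have he1 : (e : F) = 1 := by
        obtain ⟨k, rfl⟩ := h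
        push_cast
        rw [CharTwo.two_eq_zero]; ring
      -- a generator of the field with four elements is a primitive cube root of unity
      obtain ⟨x, hx0, hx1⟩ : ∃ x : F, x ≠ 0 ∧ x ≠ 1 := by
        by_contra! h
        classical
        have : (Finset.univ : Finset F) ⊆ {0, 1} := fun x _ => by
          by_cases hx : x = 0
          · simp [hx]
          · simp [h x hx]
        have := (Finset.card_le_card this).trans Finset.card_le_two
        rw [Finset.card_univ, hF] at this
        omega
      have hx := FiniteField.pow_card x
      rw [hF] at hx
      have h3 : x * (x - 1) * (x * x + x + 1) = 0 := by linear_combination hx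
      refine ⟨x, ?_⟩
      rw [hdodd, he1, one_mul, CharTwo.sub_eq_add]
      exact (mul_eq_zero.1 h3).resolve_left (mul_ne_zero hx0 (sub_ne_zero.2 hx1))
  · rw [exists_root_iff_isSquare he hp, FiniteField.isSquare_iff (by rwa [ringChar.eq F p]) hd, hF]
    have hodd : p % 2 = 1 := hpp.mod_two_eq_one_iff_ne_two.2 hp
    obtain ⟨k, hk⟩ : ∃ k, p = 2 * k + 1 := ⟨p / 2, by omega⟩
    have h1 : p ^ 2 / 2 = (p - 1) * (k + 1) := by
      have : p ^ 2 = 2 * ((p - 1) * (k + 1)) + 1 := by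
        rw [hk, Nat.add_sub_cancel]; ring
      omega
    have h2 : (d : F) ^ (p - 1) = 1 := by
      have h3 : (d : F) ^ p = d := by
        have := congrArg (ZMod.castHom dvd_rfl F) (ZMod.pow_card (d : ZMod p))
        rwa [map_pow, map_intCast] at this
      have h4 : (d : F) ^ (p - 1) * d = 1 * d := by
        rw [← pow_succ, Nat.sub_add_cancel hpp.one_le, h3, one_mul]
      exact mul_right_cancel₀ hd h4
    rw [h1, pow_mul, h2, one_pow]

theorem exists_root_iff_of_card_eq_prime (hχ : IsQuadraticCharacterOf d χ) {e : ℤ}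
    (he : d * (d - 1) = 4 * e) (hF : Nat.card F = p) (hd : (d : F) ≠ 0) :
    (∃ a : F, a * a - d * a + e = 0) ↔ χ (p : ZMod d.natAbs) = 1 := by
  have := Fintype.ofFinite F
  have hpp : p.Prime := Fact.out
  rw [Nat.card_eq_fintype_card] at hF
  by_cases hp : p = 2
  · subst hp
    have hdodd : Odd d := by
      rw [← Int.not_even_iff_odd]
      intro h
      exact hd ((CharP.intCast_eq_zero_iff F 2 d).2 h.two_dvd)
    have hd1 : (d : F) = 1 := by
      obtain ⟨k, rfl⟩ := hdodd
      push_cast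
      rw [CharTwo.two_eq_zero]; ring
    have hd4 : d % 4 = 1 := by
      have h1 : (4 : ℤ) ∣ d * (d - 1) := ⟨e, he⟩
      have h2 : IsCoprime (4 : ℤ) d := by
        rw [show (4 : ℤ) = 2 ^ 2 by norm_num]
        exact IsCoprime.pow_left (Int.isCoprime_two_left.2 hdodd)
      have := h2.dvd_of_dvd_mul_left h1
      omega
    rw [quadraticCharacter_two hχ hd4]
    have h1 : (∃ a : F, a * a - d * a + e = 0) ↔ (e : F) = 0 := by
      have hroot : ∀ a : F, a * a - d * a + e = e := by
        intro a
        have := FiniteField.pow_card a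
        rw [hF, pow_two] at this
        rw [this, hd1]; ring
      simp [hroot]
    rw [h1, CharP.intCast_eq_zero_iff F 2]
    obtain ⟨k, hk⟩ : ∃ k, d = 4 * k + 1 := ⟨d / 4, by omega⟩
    have h2 : e = d * k := by
      have : 4 * e = 4 * (d * k) := by rw [← he]; rw [hk]; ring
      linarith
    have h3 : (2 : ℤ) ∣ e ↔ (2 : ℤ) ∣ k := by
      rw [h2]
      exact ⟨fun h => (Int.isCoprime_two_left.2 hdodd).dvd_of_dvd_mul_left h,
        fun h => h.mul_left d⟩
    rw [Nat.cast_ofNat, h3]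
    omega
  · have hodd : Odd p := hpp.odd_of_ne_two hp
    rw [exists_root_iff_isSquare he hp, hχ p hodd, ← jacobiSym.legendreSym.to_jacobiSym]
    let f := ZMod.ringEquivOfPrime F hpp hF
    have hf : f (d : ZMod p) = (d : F) := map_intCast f d
    have hd' : (d : ZMod p) ≠ 0 := fun h => hd (by rw [← hf, h, map_zero])
    rw [legendreSym.eq_one_iff p hd', ← hf]
    exact ⟨fun ⟨w, hw⟩ => ⟨f.symm w, f.injective (by rw [hw, map_mul, f.apply_symm_apply])⟩,
      fun ⟨w, hw⟩ => ⟨f w, by rw [hw, map_mul]⟩⟩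

end Characters

/-! ### Values of genus characters -/

section GenusCharacter

variable {K : Type*} [Field K] [NumberField K]

/-- When `d₁ d₂` is a square in `K`, the field `K(√d₁, √d₂)` is `K(√d₁)`. -/
theorem genusField_eq_adjoin {d₁ d₂ : ℤ} {t : K} (ht : t * t = d₁ * d₂) (h1 : d₁ ≠ 0)
    {r : AlgebraicClosure K} (hr : r * r = d₁) :
    genusField K d₁ d₂ = IntermediateField.adjoin K {r} := by
  have hr0 : r ≠ 0 := by
    rintro rfl
    rw [mul_zero, eq_comm, Int.cast_eq_zero] at hr
    exact h1 hr
  have hrmem : r ∈ IntermediateField.adjoin K {r} := IntermediateField.mem_adjoin_simple_self K r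
  apply le_antisymm
  · rw [IntermediateField.adjoin_le_iff]
    rintro x (hx | hx)
    · have h : (x - r) * (x + r) = 0 := by linear_combination hx - hr
      rcases mul_eq_zero.1 h with h | h
      · rw [sub_eq_zero.1 h]; exact hrmem
      · rw [eq_neg_of_add_eq_zero_left h]; exact neg_mem hrmem
    · set u : AlgebraicClosure K := algebraMap K _ t with hu
      have hu2 : u * u = d₁ * d₂ := by rw [hu, ← map_mul, ht]; simp
      have humem : u ∈ IntermediateField.adjoin K {r} := IntermediateField.algebraMap_mem _ t
      have h : (x * r - u) * (x * r + u) = 0 := by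
        linear_combination r ^ 2 * hx + d₂ * hr - hu2
      have hxr : x * r ∈ IntermediateField.adjoin K {r} := by
        rcases mul_eq_zero.1 h with h | h
        · rw [sub_eq_zero.1 h]; exact humem
        · rw [eq_neg_of_add_eq_zero_left h]; exact neg_mem humem
      have : x = x * r * r⁻¹ := by field_simp
      rw [this]
      exact mul_mem hxr (inv_mem hrmem)
  · rw [IntermediateField.adjoin_simple_le_iff]
    exact IntermediateField.subset_adjoin K _ (Or.inl (by rw [pow_two, hr]))

theorem splitsCompletely_adjoin_iff {d e : ℤ} (he : d * (d - 1) = 4 * e)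
    {r : AlgebraicClosure K} (hr : r * r = d) (𝔭 : Ideal (𝓞 K)) [𝔭.IsMaximal]
    (hd : (d : 𝓞 K) ∉ 𝔭) :
    SplitsCompletely 𝔭 (IntermediateField.adjoin K {r}) ↔ ∃ a : 𝓞 K, a * a - d * a + e ∈ 𝔭 := by
  have hint : IsIntegral K r := Algebra.IsIntegral.isIntegral r
  have : FiniteDimensional K (IntermediateField.adjoin K {r}) :=
    IntermediateField.adjoin.finiteDimensional hint
  have : NumberField (IntermediateField.adjoin K {r}) := NumberField.of_module_finite K _
  refine splitsCompletely_iff_exists_root (r := IntermediateField.AdjoinSimple.gen K r)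
    (Subtype.ext (by simpa using hr)) he ?_ 𝔭 hd
  apply IntermediateField.lift_injective
  rw [IntermediateField.lift_top]
  exact IntermediateField.lift_adjoin_simple K _ (IntermediateField.AdjoinSimple.gen K r)

/-- The value of a genus character at a prime `𝔭` prime to `d₁`: by definition it is `1` if and only
if `(d₁ + √d₁)/2` has a conjugate in the residue field, which is always so if that field has `p²`
elements, and is decided by `χ₁(p)` if it has `p`. -/
theorem IsGenusCharacter.apply_prime (hK : Module.finrank ℚ K = 2) {τ : K ≃ₐ[ℚ] K}
    (hτ : τ ≠ AlgEquiv.refl) {χ : NarrowClassGroup K →* ℤˣ} {d₁ d₂ : ℤ}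
    {χ₁ : DirichletCharacter ℤ d₁.natAbs} {χ₂ : DirichletCharacter ℤ d₂.natAbs}
    (hχ : IsGenusCharacter χ d₁ d₂ χ₁ χ₂) (𝔭 : (Ideal (𝓞 K))⁰)
    (h𝔭 : (𝔭 : Ideal (𝓞 K)).IsPrime)
    (hcop : (Ideal.absNorm (𝔭 : Ideal (𝓞 K))).Coprime d₁.natAbs) :
    ((χ (narrowClass 𝔭) : ℤˣ) : ℤ) =
      χ₁ (Ideal.absNorm (𝔭 : Ideal (𝓞 K)) : ZMod d₁.natAbs) := by
  have hne : (𝔭 : Ideal (𝓞 K)) ≠ ⊥ := nonZeroDivisors.coe_ne_zero 𝔭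
  have hmax : (𝔭 : Ideal (𝓞 K)).IsMaximal := h𝔭.isMaximal hne
  obtain ⟨p, n, hn, hp𝔭, hp, hnorm⟩ := Ideal.exists_prime_and_absNorm_eq_pow (𝔭 : Ideal (𝓞 K))
  obtain ⟨s, hs⟩ := exists_isSqrtDiscr hK hτ
  obtain ⟨e, he⟩ := hχ.discr_left.exists_four_mul
  have : Fact p.Prime := ⟨hp⟩
  have hp0 : (p : 𝓞 K) ∈ (𝔭 : Ideal (𝓞 K)) := hp𝔭
  have hpd : p.Coprime d₁.natAbs := by
    rw [hnorm] at hcop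
    exact (Nat.coprime_pow_left_iff hn _ _).1 hcop
  have hd : (d₁ : 𝓞 K) ∉ (𝔭 : Ideal (𝓞 K)) := by
    intro h
    refine h𝔭.ne_top ((Ideal.eq_top_iff_one _).2 ?_)
    obtain ⟨u, v, huv⟩ : IsCoprime (p : ℤ) d₁ := by
      rwa [Int.isCoprime_iff_gcd_eq_one]
    have : (1 : 𝓞 K) = u * p + v * d₁ := by exact_mod_cast (congrArg (Int.cast : ℤ → 𝓞 K) huv).symm
    rw [this]
    exact Ideal.add_mem _ (Ideal.mul_mem_left _ _ hp0) (Ideal.mul_mem_left _ _ h)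
  have hd0 : d₁ ≠ 0 := by rintro rfl; exact hd (by simp)
  obtain ⟨r, hr⟩ := IsAlgClosed.exists_pow_nat_eq (d₁ : AlgebraicClosure K) two_pos
  rw [pow_two] at hr
  have hsplit := hχ.cuts_out 𝔭 h𝔭
  rw [genusField_eq_adjoin (t := (s : K)) (by rw [hs.coe_sq, ← hχ.mul_eq]; simp) hd0 hr,
    splitsCompletely_adjoin_iff he hr _ hd] at hsplit
  -- translation into the residue field
  let _ : Field (𝓞 K ⧸ (𝔭 : Ideal (𝓞 K))) := Ideal.Quotient.field _
  have hcard : Nat.card (𝓞 K ⧸ (𝔭 : Ideal (𝓞 K))) = Ideal.absNorm (𝔭 : Ideal (𝓞 K)) := rfl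
  have hfin : Finite (𝓞 K ⧸ (𝔭 : Ideal (𝓞 K))) :=
    (Ideal.absNorm_ne_zero_iff _).1 (Ideal.absNorm_ne_zero_of_nonZeroDivisors 𝔭)
  have hchar : CharP (𝓞 K ⧸ (𝔭 : Ideal (𝓞 K))) p := by
    refine (CharP.charP_iff_prime_eq_zero hp).2 ?_
    rw [← map_natCast (Ideal.Quotient.mk _), Ideal.Quotient.eq_zero_iff_mem]
    exact hp0
  have hdF : (d₁ : 𝓞 K ⧸ (𝔭 : Ideal (𝓞 K))) ≠ 0 := by
    rw [← map_intCast (Ideal.Quotient.mk (𝔭 : Ideal (𝓞 K))), Ne, Ideal.Quotient.eq_zero_iff_mem]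
    exact hd
  have hres : (∃ a : 𝓞 K, a * a - d₁ * a + e ∈ (𝔭 : Ideal (𝓞 K))) ↔
      ∃ a : 𝓞 K ⧸ (𝔭 : Ideal (𝓞 K)), a * a - d₁ * a + e = 0 := by
    rw [Ideal.Quotient.mk_surjective.exists]
    refine exists_congr fun a => ?_
    rw [← Ideal.Quotient.eq_zero_iff_mem]
    simp
  rw [hres] at hsplit
  have hn2 : n = 1 ∨ n = 2 := by
    have h1 : Ideal.absNorm (𝔭 : Ideal (𝓞 K)) ∣ p ^ 2 := by
      have := Ideal.absNorm_dvd_absNorm_of_le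
        ((Ideal.span_singleton_le_iff_mem (𝔭 : Ideal (𝓞 K))).2 hp0)
      rwa [Ideal.absNorm_span_natCast, NumberField.RingOfIntegers.rank, hK] at this
    rw [hnorm, Nat.pow_dvd_pow_iff_le_right hp.one_lt] at h1
    omega
  have hiff : χ (narrowClass 𝔭) = 1 ↔
      χ₁ (Ideal.absNorm (𝔭 : Ideal (𝓞 K)) : ZMod d₁.natAbs) = 1 := by
    rw [hsplit]
    rcases hn2 with rfl | rfl
    · rw [pow_one] at hnorm
      rw [exists_root_iff_of_card_eq_prime hχ.character_left he (hcard.trans hnorm) hdF, hnorm]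
    · refine iff_of_true (exists_root_of_card_eq_sq he (hcard.trans hnorm) hdF) ?_
      rw [hnorm, Nat.cast_pow, map_pow, pow_two, quadraticCharacter_sq hpd]
  have hsq := quadraticCharacter_sq (χ := χ₁) hcop
  rcases Int.units_eq_one_or (χ (narrowClass 𝔭)) with h | h
  · rw [hiff.1 h, h]; rfl
  · rcases mul_self_eq_one_iff.1 hsq with h1 | h1
    · rw [hiff.2 h1] at h
      exact absurd h (by decide)
    · rw [h, h1]; rfl

theorem IsGenusCharacter.apply_narrowClass (hK : Module.finrank ℚ K = 2) {τ : K ≃ₐ[ℚ] K}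
    (hτ : τ ≠ AlgEquiv.refl) {χ : NarrowClassGroup K →* ℤˣ} {d₁ d₂ : ℤ}
    {χ₁ : DirichletCharacter ℤ d₁.natAbs} {χ₂ : DirichletCharacter ℤ d₂.natAbs}
    (hχ : IsGenusCharacter χ d₁ d₂ χ₁ χ₂) (I : (Ideal (𝓞 K))⁰)
    (hcop : (Ideal.absNorm (I : Ideal (𝓞 K))).Coprime d₁.natAbs) :
    ((χ (narrowClass I) : ℤˣ) : ℤ) =
      χ₁ (Ideal.absNorm (I : Ideal (𝓞 K)) : ZMod d₁.natAbs) := by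
  obtain ⟨I, hI⟩ := I
  induction I using UniqueFactorizationMonoid.induction_on_prime with
  | h₁ => exact absurd rfl (nonZeroDivisors.ne_zero hI)
  | h₂ J hJ =>
    obtain rfl : J = 1 := by simpa using hJ
    have h1 : narrowClass (⟨1, hI⟩ : (Ideal (𝓞 K))⁰) = 1 := narrowClass_one
    rw [h1, map_one]
    simp
  | h₃ J P hJ0 hP IH =>
    have hJ : J ∈ (Ideal (𝓞 K))⁰ := mem_nonZeroDivisors_of_ne_zero hJ0
    have hP0 : P ∈ (Ideal (𝓞 K))⁰ := mem_nonZeroDivisors_of_ne_zero hP.ne_zero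
    have hmul : (⟨P * J, hI⟩ : (Ideal (𝓞 K))⁰) = ⟨P, hP0⟩ * ⟨J, hJ⟩ := rfl
    simp only [map_mul] at hcop ⊢
    have h1 := IH hJ (Nat.Coprime.coprime_mul_left hcop)
    have h2 := hχ.apply_prime hK hτ ⟨P, hP0⟩ (Ideal.isPrime_of_prime hP)
      (Nat.Coprime.coprime_mul_right hcop)
    rw [hmul, narrowClass_mul, map_mul, Units.val_mul, h1, h2, Nat.cast_mul, map_mul]

end GenusCharacter

/-! ### Local solubility and the quadratic character -/

section Local

open NumberTheorySymbols

/-- A non-trivial `p`-adic zero of `X² - eY² + nZ²` gives a primitive integral zero modulo `p³`. -/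
theorem exists_primitive_zero_mod {p : ℕ} [Fact p.Prime] {e n : ℤ} (v : Fin 3 → ℚ_[p]) (hv : v ≠ 0)
    (h : v 0 ^ 2 - e * v 1 ^ 2 + n * v 2 ^ 2 = 0) :
    ∃ x : Fin 3 → ℤ, (p : ℤ) ^ 3 ∣ x 0 ^ 2 - e * x 1 ^ 2 + n * x 2 ^ 2 ∧ ∃ i, ¬ (p : ℤ) ∣ x i := by
  have hp : p.Prime := Fact.out
  -- divide by a coordinate of maximal absolute value
  obtain ⟨i, hi⟩ := Finite.exists_max fun j => ‖v j‖
  have hvi : v i ≠ 0 := by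
    intro h0
    refine hv (funext fun j => ?_)
    have := hi j
    rw [h0, norm_zero] at this
    exact norm_le_zero_iff.1 this
  have hle : ∀ j, ‖v j / v i‖ ≤ 1 := fun j => by
    rw [norm_div]; exact div_le_one_of_le₀ (hi j) (norm_nonneg _)
  let w : Fin 3 → ℤ_[p] := fun j => ⟨v j / v i, hle j⟩
  have hw : w 0 ^ 2 - e * w 1 ^ 2 + n * w 2 ^ 2 = 0 := by
    apply Subtype.ext
    have : (v 0 / v i) ^ 2 - e * (v 1 / v i) ^ 2 + n * (v 2 / v i) ^ 2 = 0 := by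
      field_simp
      rw [h, mul_zero]
    have hcast : ((w 0 ^ 2 - e * w 1 ^ 2 + n * w 2 ^ 2 : ℤ_[p]) : ℚ_[p]) =
        (v 0 / v i) ^ 2 - e * (v 1 / v i) ^ 2 + n * (v 2 / v i) ^ 2 := by push_cast; rfl
    rw [hcast, this]; rfl
  have hwi : w i = 1 := Subtype.ext (div_self hvi)
  choose x hx using fun j => ZMod.intCast_surjective (PadicInt.toZModPow (p := p) 3 (w j))
  refine ⟨x, ?_, i, fun hdvd => ?_⟩
  · have h1 := congrArg (PadicInt.toZModPow (p := p) 3) hw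
    simp only [map_add, map_sub, map_mul, map_pow, map_intCast, map_zero, ← hx] at h1
    have h2 : ((x 0 ^ 2 - e * x 1 ^ 2 + n * x 2 ^ 2 : ℤ) : ZMod (p ^ 3)) = 0 := by
      push_cast; exact h1
    simpa using (ZMod.intCast_zmod_eq_zero_iff_dvd _ _).1 h2
  · have h1 : ((x i : ℤ) : ZMod (p ^ 3)) = ((1 : ℤ) : ZMod (p ^ 3)) := by
      rw [hx, hwi, map_one, Int.cast_one]
    rw [ZMod.intCast_eq_intCast_iff_dvd_sub] at h1
    have h2 : (p : ℤ) ∣ 1 - x i := (dvd_pow_self _ three_ne_zero).trans (by simpa using h1)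
    have h3 : (p : ℤ) ∣ 1 := by
      have := dvd_add h2 hdvd
      rwa [sub_add_cancel] at this
    exact hp.one_lt.ne' (by exact_mod_cast Int.eq_one_of_dvd_one (by positivity) h3)

/-- If `p` divides `e` exactly once, the last coordinate of a primitive zero modulo `p³` is prime to
`p`, and the equation modulo `p` shows that `-n` is a square. -/
theorem exists_sq_add_of_padic_zero {p : ℕ} [Fact p.Prime] {e n : ℤ} (v : Fin 3 → ℚ_[p])
    (hv : v ≠ 0) (h : v 0 ^ 2 - e * v 1 ^ 2 + n * v 2 ^ 2 = 0) (he : (p : ℤ) ∣ e)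
    (he2 : ¬ (p : ℤ) ^ 2 ∣ e) : ∃ t : ℤ, (p : ℤ) ∣ t ^ 2 + n := by
  have hp : Prime (p : ℤ) := Nat.prime_iff_prime_int.1 Fact.out
  obtain ⟨x, hx, i, hi⟩ := exists_primitive_zero_mod v hv h
  obtain ⟨e', rfl⟩ := he
  have he' : ¬ (p : ℤ) ∣ e' := fun ⟨c, hc⟩ => he2 ⟨c, by rw [hc]; ring⟩
  have h2 : ¬ (p : ℤ) ∣ x 2 := by
    rintro ⟨c, hc⟩
    obtain ⟨k, hk⟩ := hx
    have h0 : (p : ℤ) ∣ x 0 := by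
      refine hp.dvd_of_dvd_pow (n := 2) ⟨p ^ 2 * k + e' * x 1 ^ 2 - n * p * c ^ 2, ?_⟩
      rw [hc] at hk
      linear_combination hk
    obtain ⟨b, hb⟩ := h0
    have h1 : (p : ℤ) ∣ x 1 := by
      have : (p : ℤ) ∣ e' * x 1 ^ 2 := by
        refine ⟨b ^ 2 + n * c ^ 2 - p * k, ?_⟩
        rw [hc, hb] at hk
        apply mul_left_cancel₀ hp.ne_zero
        linear_combination -hk
      exact hp.dvd_of_dvd_pow ((hp.dvd_or_dvd this).resolve_left he')
    fin_cases i
    · exact hi ⟨b, hb⟩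
    · exact hi h1
    · exact hi ⟨c, hc⟩
  obtain ⟨u, w, huw⟩ : IsCoprime (p : ℤ) (x 2) := (Prime.coprime_iff_not_dvd hp).2 h2
  obtain ⟨k, hk⟩ := hx
  refine ⟨w * x 0, w ^ 2 * (p ^ 2 * k + e' * x 1 ^ 2) + n * u * (1 + w * x 2), ?_⟩
  linear_combination w ^ 2 * hk - n * (1 + w * x 2) * huw

/-- The values of `X² - eY²` at primitive solutions, compared modulo `8`. -/
theorem mod_eight_of_dyadic_zero {e n : ℤ} (v : Fin 3 → ℚ_[2])
    (hv : v ≠ 0) (h : v 0 ^ 2 - e * v 1 ^ 2 + n * v 2 ^ 2 = 0) (hn : n % 2 = 1) :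
    (e % 4 = 3 → (-n) % 4 = 1) ∧
      (e % 4 = 2 → (-n) % 8 = 1 ∨ (-n) % 8 = (1 - e) % 8) := by
  obtain ⟨x, hx, i, hi⟩ := exists_primitive_zero_mod v hv h
  have hsq : ∀ y : ℤ, ∃ b : ℤ, (y % 2 = 1 ∧ y ^ 2 = 8 * b + 1) ∨
      (y % 2 = 0 ∧ (y ^ 2 = 8 * b ∨ y ^ 2 = 8 * b + 4)) := by
    intro y
    rcases Int.emod_two_eq_zero_or_one y with h0 | h1
    · obtain ⟨c, rfl⟩ : ∃ c, y = 2 * c := ⟨y / 2, by omega⟩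
      rcases Int.even_or_odd' c with ⟨b, rfl | rfl⟩
      · exact ⟨2 * b ^ 2, Or.inr ⟨h0, Or.inl (by ring)⟩⟩
      · exact ⟨2 * b ^ 2 + 2 * b, Or.inr ⟨h0, Or.inr (by ring)⟩⟩
    · obtain ⟨c, rfl⟩ : ∃ c, y = 2 * c + 1 := ⟨y / 2, by omega⟩
      rcases Int.even_or_odd' c with ⟨b, rfl | rfl⟩
      · exact ⟨2 * b ^ 2 + b, Or.inl ⟨h1, by ring⟩⟩
      · exact ⟨2 * b ^ 2 + 3 * b + 1, Or.inl ⟨h1, by ring⟩⟩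
  have hodd : x 0 % 2 = 1 ∨ x 1 % 2 = 1 ∨ x 2 % 2 = 1 := by
    push_cast at hi
    fin_cases i
    · left; simp only [Fin.zero_eta] at hi; omega
    · right; left; simp only [Fin.mk_one] at hi; omega
    · right; right; simp only [Fin.reduceFinMk] at hi; omega
  obtain ⟨k, hk⟩ := hx
  obtain ⟨a, ha⟩ := hsq (x 0)
  obtain ⟨b, hb⟩ := hsq (x 1)
  obtain ⟨c, hc⟩ := hsq (x 2)
  push_cast at hk
  rcases ha with ⟨ha, ha'⟩ | ⟨ha, ha' | ha'⟩ <;> rcases hb with ⟨hb, hb'⟩ | ⟨hb, hb' | hb'⟩ <;>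
    rcases hc with ⟨hc, hc'⟩ | ⟨hc, hc' | hc'⟩ <;> rw [ha', hb', hc'] at hk <;>
    ring_nf at hk <;> constructor <;> intro he <;> omega

theorem jacobiSym_eq_one_of_local_squares {m : ℤ} {k : ℕ} (hcop : m.gcd k = 1)
    (h : ∀ p : ℕ, p.Prime → p ∣ k → ∃ t : ℤ, (p : ℤ) ∣ t ^ 2 - m) : J(m | k) = 1 := by
  refine (jacobiSym.eq_one_or_neg_one hcop).resolve_right fun h1 => ?_
  obtain ⟨p, hp, hpk, hJ⟩ := jacobiSym.eq_neg_one_at_prime_divisor_of_eq_neg_one h1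
  obtain ⟨t, ht⟩ := h p hp hpk
  refine ZMod.nonsquare_of_jacobiSym_eq_neg_one hJ ⟨(t : ZMod p), ?_⟩
  have := (ZMod.intCast_zmod_eq_zero_iff_dvd _ _).2 ht
  push_cast at this
  linear_combination -this

/-- A form of the reciprocity law: the quadratic character attached to the fundamental discriminant
`d` takes the value `1` at integers that are local norms at all primes dividing `d`. -/
theorem quadraticCharacter_eq_one_of_local {d : ℤ} {χ : DirichletCharacter ℤ d.natAbs}
    (hχ : IsQuadraticCharacterOf d χ) {m : ℤ} (hcop : IsCoprime m d)
    (hodd : ∀ p : ℕ, p.Prime → p ≠ 2 → (p : ℤ) ∣ d → ∃ t : ℤ, (p : ℤ) ∣ t ^ 2 - m)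
    (h2 : d % 4 = 1 ∨ (d % 16 = 12 ∧ m % 4 = 1) ∨
      (d % 16 = 8 ∧ (m % 8 = 1 ∨ m % 8 = (1 - d / 4) % 8))) :
    χ (m : ZMod d.natAbs) = 1 := by
  have hd0 : d ≠ 0 := by rintro rfl; omega
  -- a positive odd representative of `m` modulo `|d|`
  obtain ⟨N, j, hN, hNodd⟩ : ∃ (N : ℕ) (j : ℤ), (N : ℤ) = m + j * d ∧ Odd N := by
    have hm2 : d % 2 = 0 → m % 2 = 1 := by
      intro h
      by_contra h'
      have : (2 : ℤ) ∣ 1 := by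
        have hu := hcop.isUnit_of_dvd' (x := 2) (by omega) (by omega)
        exact hu.dvd
      omega
    have hsq : 1 ≤ d * d := by
      have := mul_self_pos.2 hd0
      omega
    have hbound : 0 ≤ m + (2 * |m| * d) * d := by
      have h1 := neg_abs_le m
      have h2 := abs_nonneg m
      nlinarith
    by_cases hpar : (m + (2 * |m| * d) * d) % 2 = 1
    · refine ⟨(m + (2 * |m| * d) * d).toNat, 2 * |m| * d, Int.toNat_of_nonneg hbound, ?_⟩
      rw [Nat.odd_iff]; omega
    · refine ⟨(m + (2 * |m| * d + d) * d).toNat, 2 * |m| * d + d,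
        Int.toNat_of_nonneg (by nlinarith), ?_⟩
      have e1 : m + (2 * |m| * d + d) * d = (m + (2 * |m| * d) * d) + d * d := by ring
      have e2 : (2 * |m| * d) * d = 2 * (|m| * d * d) := by ring
      have hdodd : d % 2 = 1 := by
        by_contra h
        have := hm2 (by omega)
        omega
      have e3 : (d * d) % 2 = 1 := by rw [Int.mul_emod, hdodd]; rfl
      rw [Nat.odd_iff]; omega
  have hχm : χ (m : ZMod d.natAbs) = J(d | N) := by
    rw [← hχ N hNodd]
    congr 1
    have : ((N : ℤ) : ZMod d.natAbs) = ((m + j * d : ℤ) : ZMod d.natAbs) := by rw [hN]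
    have hd : ((d : ℤ) : ZMod d.natAbs) = 0 := by
      rw [ZMod.intCast_zmod_eq_zero_iff_dvd]; simp
    push_cast at this
    rw [this, hd]; ring
  -- the symbol is trivial at every odd divisor of `d`
  have hJ : ∀ c : ℤ, c % 4 = 1 → c ∣ d → J(c | N) = 1 := by
    intro c hc hcd
    rw [jacobiSym_eq_of_one_mod_four hc hNodd]
    have hcopN : IsCoprime (N : ℤ) d := by
      rw [hN]; exact IsCoprime.add_mul_right_left_iff.2 hcop
    refine jacobiSym_eq_one_of_local_squares ?_ fun p hp hpc => ?_
    · have := hcopN.of_isCoprime_of_dvd_right hcd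
      rw [Int.isCoprime_iff_gcd_eq_one] at this
      rw [Int.gcd, Int.natAbs_natCast, Int.natAbs_natCast]
      exact this
    · have hpc' : (p : ℤ) ∣ c := Int.natCast_dvd.2 hpc
      have hp2 : p ≠ 2 := by rintro rfl; omega
      obtain ⟨t, ht⟩ := hodd p hp hp2 (hpc'.trans hcd)
      refine ⟨t, ?_⟩
      have : t ^ 2 - (N : ℤ) = (t ^ 2 - m) - j * d := by rw [hN]; ring
      rw [this]
      exact dvd_sub ht ((hpc'.trans hcd).mul_left j)
  have hneg : ∀ c : ℤ, c % 4 = 3 → c ∣ d → J(c | N) = ZMod.χ₄ N := by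
    intro c hc hcd
    have h1 := hJ (-c) (by omega) ((neg_dvd).2 hcd)
    rw [jacobiSym.neg _ hNodd] at h1
    rcases Nat.odd_mod_four_iff.1 (Nat.odd_iff.1 hNodd) with h3 | h3
    · rw [ZMod.χ₄_nat_one_mod_four h3] at h1 ⊢; linarith
    · rw [ZMod.χ₄_nat_three_mod_four h3] at h1 ⊢; linarith
  rw [hχm]
  rcases h2 with h2 | ⟨h2, hm⟩ | ⟨h2, hm⟩
  · exact hJ d h2 dvd_rfl
  · obtain ⟨c, rfl⟩ : ∃ c, d = 4 * c := ⟨d / 4, by omega⟩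
    rw [jacobiSym.mul_left, jacobiSym.at_four hNodd, one_mul, hneg c (by omega) (Dvd.intro_left _ rfl)]
    have hN4 : N % 4 = 1 := by
      have : (N : ℤ) = m + 4 * (j * c) := by rw [hN]; ring
      omega
    exact ZMod.χ₄_nat_one_mod_four hN4
  · obtain ⟨c, rfl⟩ : ∃ c, d = 4 * (2 * c) := ⟨d / 8, by omega⟩
    have hc2 : c % 2 = 1 := by omega
    have hN8 : (N : ℤ) % 8 = m % 8 := by
      have : (N : ℤ) = m + 8 * (j * c) := by rw [hN]; ring
      omega
    have hcd : c ∣ 4 * (2 * c) := ⟨8, by ring⟩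
    have hdiv : 4 * (2 * c) / 4 = 2 * c := by omega
    rw [hdiv] at hm
    rw [jacobiSym.mul_left, jacobiSym.mul_left, jacobiSym.at_four hNodd, one_mul,
      jacobiSym.at_two hNodd, ZMod.χ₈_nat_eq_if_mod_eight]
    have hN2 : ¬ N % 2 = 0 := by have := Nat.odd_iff.1 hNodd; omega
    rw [if_neg hN2]
    rcases (by omega : c % 4 = 1 ∨ c % 4 = 3) with hc | hc
    · rw [hJ c hc hcd, mul_one, if_pos (by omega)]
    · rw [hneg c hc hcd]
      rcases hm with hm | hm
      · rw [if_pos (by omega), ZMod.χ₄_nat_one_mod_four (by omega)]; rfl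
      · rw [if_neg (by omega), ZMod.χ₄_nat_three_mod_four (by omega)]; rfl

end Local

/-! ### Norms at unramified primes -/

section Unramified

variable {α β : ℚ}

/-- If `(α, β / ℚ)` contains anticommuting elements with squares `d` and `-n`, and is split at `p`,
then `-n` is a norm from `ℚ_p(√d)`, in the sense that `X² - dY² + nZ²` has a non-trivial `p`-adic
zero. -/
theorem exists_padic_zero_of_not_isRamifiedAt {p : ℕ} [Fact p.Prime] (hram : ¬ IsRamifiedAt α β p)
    {d n : ℤ} (hd : d ≠ 0) (hn : n ≠ 0) (i j : ℍ[ℚ,α,β])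
    (hi : i * i = algebraMap ℚ _ (d : ℚ)) (hj : j * j = algebraMap ℚ _ (-n : ℚ))
    (hij : j * i = -(i * j)) :
    ∃ v : Fin 3 → ℚ_[p], v ≠ 0 ∧ v 0 ^ 2 - d * v 1 ^ 2 + n * v 2 ^ 2 = 0 := by
  let f := QuaternionAlgebra.baseChange ℚ_[p] α β
  have hd' : (d : ℚ_[p]) ≠ 0 := by exact_mod_cast hd
  have hn' : (-n : ℚ_[p]) ≠ 0 := neg_ne_zero.2 (by exact_mod_cast hn)
  have hcast : ∀ q : ℚ, f (algebraMap ℚ _ q) = algebraMap ℚ_[p] _ (q : ℚ_[p]) := fun q => by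
    rw [AlgHom.commutes, IsScalarTower.algebraMap_apply ℚ ℚ_[p]]; rfl
  let E := QuaternionAlgebra.equivOfPair hd' hn' (f i) (f j)
    (by rw [← map_mul, hi, hcast]; simp) (by rw [← map_mul, hj, hcast]; simp)
    (by rw [← map_mul, hij, map_neg, map_mul])
  rw [IsRamifiedAt] at hram
  push Not at hram
  obtain ⟨y, hy0, hy⟩ := hram
  obtain ⟨x, rfl⟩ := E.surjective y
  have hx0 : x ≠ 0 := by rintro rfl; exact hy0 (map_zero E)
  have hx : (x * star x).re = 0 := by
    by_contra h
    apply hy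
    refine IsUnit.map E ?_
    have h1 := QuaternionAlgebra.mul_star_eq_coe x
    have h2 : star x * x = ((x * star x).re : ℍ[ℚ_[p],(d : ℚ_[p]),(-n : ℚ_[p])]) := by
      ext <;> simp <;> ring
    have h3 : ∀ c : ℚ_[p], c ≠ 0 →
        (c : ℍ[ℚ_[p],(d : ℚ_[p]),(-n : ℚ_[p])]) *
          ((c⁻¹ : ℚ_[p]) : ℍ[ℚ_[p],(d : ℚ_[p]),(-n : ℚ_[p])]) = 1 := by
      intro c hc
      rw [← QuaternionAlgebra.coe_mul, mul_inv_cancel₀ hc, QuaternionAlgebra.coe_one]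
    refine ⟨⟨x, star x * (((x * star x).re)⁻¹ : ℚ_[p]), ?_, ?_⟩, rfl⟩
    · rw [← mul_assoc]
      nth_rewrite 1 [h1]
      exact h3 _ h
    · rw [← QuaternionAlgebra.coe_commutes, mul_assoc, h2, QuaternionAlgebra.coe_commutes]
      exact h3 _ h
  have hnorm : x.re ^ 2 - d * x.imI ^ 2 + n * (x.imJ ^ 2 - d * x.imK ^ 2) = 0 := by
    simp at hx
    linear_combination hx
  -- with `u = N(C)`, the norm form of `x = A + C j` is `N(A) + n N(C)`, and `u` times it is
  -- `N(A C) + n u²`; if `u = 0`, then `C` is isotropic, or zero, in which case `A` is isotropic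
  have hvec : ∀ a b c : ℚ_[p], ![a, b, c] = 0 ↔ a = 0 ∧ b = 0 ∧ c = 0 := by
    intro a b c
    rw [← List.ofFn_inj]
    simp
  set u := x.imJ ^ 2 - d * x.imK ^ 2 with hu
  by_cases hu0 : u = 0
  · by_cases hJK : x.imJ = 0 ∧ x.imK = 0
    · refine ⟨![x.re, x.imI, 0], ?_, ?_⟩
      · rw [Ne, hvec]
        rintro ⟨h1, h2, -⟩
        exact hx0 (QuaternionAlgebra.ext h1 h2 hJK.1 hJK.2)
      · simp only [Matrix.cons_val]
        rw [hu0] at hnorm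
        linear_combination hnorm
    · refine ⟨![x.imJ, x.imK, 0], ?_, ?_⟩
      · rw [Ne, hvec]
        exact fun h => hJK ⟨h.1, h.2.1⟩
      · simp only [Matrix.cons_val]
        linear_combination hu0
  · refine ⟨![x.re * x.imJ + d * x.imI * x.imK, x.re * x.imK + x.imI * x.imJ, u], ?_, ?_⟩
    · rw [Ne, hvec]
      exact fun h => hu0 h.2.2
    · simp only [Matrix.cons_val]
      have : (x.re * x.imJ + d * x.imI * x.imK) ^ 2 - d * (x.re * x.imK + x.imI * x.imJ) ^ 2 =
          (x.re ^ 2 - d * x.imI ^ 2) * u := by rw [hu]; ring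
      rw [this]
      linear_combination u * hnorm

end Unramified

/-! ### Primes dividing the discriminant -/

section Discriminant

variable {K : Type*} [Field K] [NumberField K] (hK : Module.finrank ℚ K = 2) {τ : K ≃ₐ[ℚ] K}
  (hτ : τ ≠ AlgEquiv.refl)
include hK hτ

/-- An inert prime `ℓ` does not divide the discriminant: otherwise `w = √d_K / ℓ` is integral, and
`d_K = ℓ² w²` contradicts the fact that the discriminant is fundamental; for `ℓ = 2` this requires
`w² ≡ 0, 1` modulo `4`, obtained from divisibility of `w` or `1 + w` by `2`. -/
theorem not_dvd_discr_of_inert (hK4 : IsDiscr (NumberField.discr K)) {ℓ : ℕ} (hℓ : ℓ.Prime)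
    (h : (Ideal.span {(ℓ : 𝓞 K)}).IsPrime) : ¬ (ℓ : ℤ) ∣ NumberField.discr K := by
  intro hdvd
  obtain ⟨s, hs⟩ := exists_isSqrtDiscr hK hτ
  have hnorm : ∀ x : 𝓞 K, ∀ y : 𝓞 K, x = ℓ * y →
      Algebra.norm ℤ x = (ℓ : ℤ) ^ 2 * Algebra.norm ℤ y := by
    rintro _ y rfl
    rw [map_mul, ← Int.cast_natCast, ← eq_intCast (algebraMap ℤ (𝓞 K)), Algebra.norm_algebraMap,
      NumberField.RingOfIntegers.rank, hK]
  have hintnorm : ∀ (x : 𝓞 K) (c : ℤ), x * conjInt τ x = c → Algebra.norm ℤ x = c := by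
    intro x c hc
    have := intNorm_eq hK hτ x
    rw [hc] at this
    exact_mod_cast this
  have hmem : ∀ (x : 𝓞 K) (c : ℤ), x * x = c → (ℓ : ℤ) ∣ c → ∃ y, x = ℓ * y := by
    rintro x _ hx ⟨b, rfl⟩
    have h1 : x * x ∈ Ideal.span {(ℓ : 𝓞 K)} := by
      rw [hx, Ideal.mem_span_singleton]
      exact ⟨b, by push_cast; ring⟩
    exact Ideal.mem_span_singleton.1 ((h.mem_or_mem h1).elim id id)
  obtain ⟨w, hw⟩ := hmem s _ hs.sq hdvd
  have hsnorm : Algebra.norm ℤ s = -NumberField.discr K :=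
    hintnorm s _ (by rw [hs.conj, mul_neg, hs.sq]; simp)
  have hdisc : NumberField.discr K = (ℓ : ℤ) ^ 2 * (-Algebra.norm ℤ w) := by
    linear_combination hsnorm - hnorm s w hw
  have hnotdisc : ¬ IsDiscr (-Algebra.norm ℤ w) := fun hc => by
    have := hs.fundamental hdisc hc
    rw [Int.isUnit_iff] at this
    have := hℓ.two_le
    omega
  obtain ⟨t, ht⟩ : ∃ t : ℤ, t = Algebra.norm ℤ w := ⟨_, rfl⟩
  by_cases hℓ2 : ℓ = 2
  · subst hℓ2
    have hℓ0 : ((2 : ℕ) : 𝓞 K) ≠ 0 := by norm_num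
    have hwconj : conjInt τ w = -w := by
      have h1 := hs.conj
      rw [hw, map_mul, map_natCast] at h1
      exact mul_left_cancel₀ hℓ0 (by rw [h1]; ring)
    have hww : w * w = ((-t : ℤ) : 𝓞 K) := by
      rw [ht, Int.cast_neg, intNorm_eq hK hτ, hwconj]; ring
    rw [← ht] at hnotdisc
    simp only [IsDiscr] at hnotdisc
    rcases Int.even_or_odd t with he | ho
    · obtain ⟨y, hy⟩ := hmem w _ hww (by obtain ⟨a, ha⟩ := he; exact ⟨-a, by push_cast; omega⟩)
      have h1 := hnorm w y hy
      rw [← ht] at h1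
      push_cast at h1
      omega
    · have h1 : (1 + w) * (1 + w) ∈ Ideal.span {((2 : ℕ) : 𝓞 K)} := by
        rw [Ideal.mem_span_singleton]
        obtain ⟨a, ha⟩ := ho
        refine ⟨w - a, ?_⟩
        have h2 : (1 + w) * (1 + w) = 1 + 2 * w + w * w := by ring
        rw [h2, hww, ha]
        push_cast
        ring
      obtain ⟨y, hy⟩ := Ideal.mem_span_singleton.1 ((h.mem_or_mem h1).elim id id)
      have h2 := hnorm (1 + w) y hy
      have h3 : Algebra.norm ℤ (1 + w) = 1 + t := hintnorm _ _ (by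
        have : (1 + w) * conjInt τ (1 + w) = 1 - w * w := by
          rw [map_add, map_one, hwconj]; ring
        rw [this, hww]; push_cast; ring)
      rw [h3] at h2
      push_cast at h2
      omega
  · -- an odd square is `1` modulo `4`
    have hodd := hℓ.odd_of_ne_two hℓ2
    obtain ⟨a, ha⟩ := hodd
    have hsq : (ℓ : ℤ) ^ 2 = 4 * (a ^ 2 + a) + 1 := by rw [ha]; push_cast; ring
    refine hnotdisc ?_
    rw [hdisc, hsq, ← ht] at hK4
    rw [← ht]
    have : (4 * ((a : ℤ) ^ 2 + a) + 1) * -t = 4 * (((a : ℤ) ^ 2 + a) * -t) + -t := by ring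
    rw [IsDiscr, this] at hK4
    rw [IsDiscr]
    omega

/-- A prime with two primes above it does not divide the discriminant: modulo a prime above a
divisor of the discriminant, conjugation is trivial. -/
theorem not_dvd_discr_of_split {ℓ : ℕ}
    (h : ((Ideal.span {(ℓ : ℤ)}).primesOver (𝓞 K)).ncard = 2) :
    ¬ (ℓ : ℤ) ∣ NumberField.discr K := by
  intro hdvd
  obtain ⟨s, hs⟩ := exists_isSqrtDiscr hK hτ
  obtain ⟨P, Q, hPQ, hset⟩ := Set.ncard_eq_two.1 h
  have hP : P ∈ (Ideal.span {(ℓ : ℤ)}).primesOver (𝓞 K) := by rw [hset]; exact Or.inl rfl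
  have hQ : Q ∈ (Ideal.span {(ℓ : ℤ)}).primesOver (𝓞 K) := by rw [hset]; exact Or.inr rfl
  have hmem : ∀ P ∈ (Ideal.span {(ℓ : ℤ)}).primesOver (𝓞 K), ∀ c : ℤ,
      (c : 𝓞 K) ∈ P ↔ (ℓ : ℤ) ∣ c := by
    rintro P ⟨-, hP⟩ c
    rw [← Ideal.mem_span_singleton, Ideal.mem_of_liesOver P (Ideal.span {(ℓ : ℤ)}), eq_intCast]
  have hle : ∀ P ∈ (Ideal.span {(ℓ : ℤ)}).primesOver (𝓞 K),
      ∀ Q ∈ (Ideal.span {(ℓ : ℤ)}).primesOver (𝓞 K), P ≤ Q := by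
    intro P hP Q hQ x hx
    have hsQ : s ∈ Q := by
      have h1 : s * s ∈ Q := by rw [hs.sq, hmem Q hQ]; exact hdvd
      exact (hQ.1.mem_or_mem h1).elim id id
    have h1 : x * conjInt τ x ∈ Q := by
      rw [← intNorm_eq hK hτ, hmem Q hQ, ← hmem P hP, intNorm_eq hK hτ]
      exact P.mul_mem_right _ hx
    rcases hQ.1.mem_or_mem h1 with h2 | h2
    · exact h2
    · obtain ⟨k, hk⟩ := hs.exists_sub_conj x
      rw [sub_eq_iff_eq_add.1 hk]
      exact Q.add_mem (Q.mul_mem_left _ hsQ) h2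
  exact hPQ (le_antisymm (hle P hP Q hQ) (hle Q hQ P hP))

end Discriminant

/-! ### Elements intertwining an embedding and its conjugate -/

section Intertwiner

variable {K : Type*} [Field K] [NumberField K] {α β : ℚ}

theorem reducedNorm_units_ne_zero (u : ℍ[ℚ,α,β]ˣ) : reducedNorm (u : ℍ[ℚ,α,β]) ≠ 0 := by
  intro h
  have h1 := reducedNorm_mul (u : ℍ[ℚ,α,β]) (u⁻¹ : ℍ[ℚ,α,β]ˣ)
  rw [Units.mul_inv, h, zero_mul, reducedNorm_one] at h1
  exact one_ne_zero h1

theorem reducedNorm_embedding_ne_zero (ψ : K →ₐ[ℚ] ℍ[ℚ,α,β]) {x : K} (hx : x ≠ 0) :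
    reducedNorm (ψ x) ≠ 0 := by
  have h := reducedNorm_units_ne_zero (Units.map (ψ : K →* ℍ[ℚ,α,β]) (Units.mk0 x hx))
  exact h

theorem conjEmbedding_conjEmbedding (u v : ℍ[ℚ,α,β]ˣ) (ψ : K →ₐ[ℚ] ℍ[ℚ,α,β]) :
    conjEmbedding u (conjEmbedding v ψ) = conjEmbedding (u * v) ψ := by
  ext x <;> simp [conjEmbedding, mul_assoc]

theorem conjEmbedding_eq_iff (u : ℍ[ℚ,α,β]ˣ) (ψ φ : K →ₐ[ℚ] ℍ[ℚ,α,β]) :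
    φ = conjEmbedding u ψ ↔ ∀ x, (u : ℍ[ℚ,α,β]) * ψ x = φ x * u := by
  rw [DFunLike.ext_iff]
  refine forall_congr' fun x => ?_
  change φ x = u * ψ x * (u⁻¹ : ℍ[ℚ,α,β]ˣ) ↔ _
  rw [Units.eq_mul_inv_iff_mul_eq, eq_comm]

variable (hK : Module.finrank ℚ K = 2) {τ : K ≃ₐ[ℚ] K} (hτ : τ ≠ AlgEquiv.refl)
  {ψ : K →ₐ[ℚ] ℍ[ℚ,α,β]} {b : ℍ[ℚ,α,β]} (hb : ∀ x, b * ψ x = ψ (τ x) * b)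

include hb in
theorem intertwiner_anticommute {s : 𝓞 K} (hs : IsSqrtDiscr τ s) (z : K) :
    ψ z * b * ψ s = -(ψ s * (ψ z * b)) := by
  rw [mul_assoc, hb, hs.coe_conj, map_neg, neg_mul, mul_neg, ← mul_assoc, ← mul_assoc, ← map_mul,
    ← map_mul, mul_comm]

theorem embedding_sqrtDiscr_mul_self {s : 𝓞 K} (hs : IsSqrtDiscr τ s) :
    ψ s * ψ s = algebraMap ℚ _ (NumberField.discr K : ℚ) := by
  rw [← map_mul, hs.coe_sq, AlgHom.commutes]

include hK hτ hb

/-- If conjugation by `b` induces `τ` on `ψ(K)`, then `b` is pure and `(ψ(z) b)² = N(z) b²`. -/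
theorem intertwiner_mul_self (z : K) :
    ψ z * b * (ψ z * b) = algebraMap ℚ _ (-(Algebra.norm ℚ z * reducedNorm b)) := by
  obtain ⟨s, hs⟩ := exists_isSqrtDiscr hK hτ
  have hre : b.re = 0 := by
    refine re_eq_zero_of_anticommute (reducedNorm_embedding_ne_zero ψ hs.ne_zero) ?_
    have := intertwiner_anticommute hb hs 1
    rw [map_one, one_mul] at this
    rw [this, neg_neg]
  have h1 : ψ z * b * (ψ z * b) = ψ z * (b * ψ z) * b := by simp only [mul_assoc]
  rw [h1, hb, ← mul_assoc, ← map_mul, ← algebraMap_norm_eq hK hτ, AlgHom.commutes, mul_assoc,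
    mul_self_of_re_eq_zero hre, ← map_mul, mul_neg]

/-- The canonical involution of the quaternion algebra induces the conjugation of `K`. -/
theorem star_embedding (hb0 : reducedNorm b ≠ 0) (x : K) : star (ψ x) = ψ (τ x) := by
  obtain ⟨s, hs⟩ := exists_isSqrtDiscr hK hτ
  have hstar : star (ψ s) = -ψ s := by
    refine QuaternionAlgebra.star_eq_neg.2 (re_eq_zero_of_anticommute hb0 ?_)
    have := intertwiner_anticommute hb hs 1
    rwa [map_one, one_mul] at this
  obtain ⟨p, q, rfl⟩ := hs.exists_rat_add hK hτ x
  have hrat : ∀ c : ℚ, star (algebraMap ℚ ℍ[ℚ,α,β] c) = algebraMap ℚ _ c := fun c =>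
    QuaternionAlgebra.star_coe c
  rw [map_add, map_mul, map_add, map_mul, hs.coe_conj, AlgEquiv.commutes, AlgEquiv.commutes, map_add,
    map_mul, map_neg, AlgHom.commutes, AlgHom.commutes, star_add, star_mul, hstar, hrat, hrat,
    Algebra.commutes]

/-- A generator of positive reduced norm of the left ideal `R ψ(I)` has reduced norm `N(I)`: since
`I · τ(I) = (N(I))`, each of the two numbers divides the other in `R`. -/
theorem reducedNorm_generator {R : Subring ℍ[ℚ,α,β]} {M : ℕ} (hR : IsEichlerOrder R M)
    (hψ : IsOptimalEmbedding R ψ) (hb0 : reducedNorm b ≠ 0) (I : (Ideal (𝓞 K))⁰) {a : ℍ[ℚ,α,β]}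
    (ha : 0 < reducedNorm a)
    (hspan : Submodule.span R ((fun x : 𝓞 K => ψ (x : K)) '' ((I : Ideal (𝓞 K)) : Set (𝓞 K))) =
      Submodule.span R {a}) :
    reducedNorm a = Ideal.absNorm (I : Ideal (𝓞 K)) := by
  have hstar := star_embedding hK hτ hb hb0
  have hψR : ∀ x : 𝓞 K, ψ x ∈ R := fun x => by
    have h : ψ (x : K) ∈ Set.range ψ ∩ (R : Set ℍ[ℚ,α,β]) := by
      rw [hψ]; exact ⟨x, rfl⟩
    exact h.2
  set N : ℕ := Ideal.absNorm (I : Ideal (𝓞 K)) with hN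
  have hNpos : (0 : ℚ) < N := by exact_mod_cast Ideal.absNorm_pos_of_nonZeroDivisors I
  have hmul := mul_map_conj hK hτ (I : Ideal (𝓞 K))
  -- `N(I) ∈ nrd(a) R`
  have h1 : ∀ w ∈ (I : Ideal (𝓞 K)) * (I : Ideal (𝓞 K)).map (conjInt τ),
      ∃ r ∈ R, ψ w = algebraMap ℚ _ (reducedNorm a) * r := by
    have hgen : ∀ x ∈ (I : Ideal (𝓞 K)), ∃ r ∈ R, ψ x = r * a := by
      intro x hx
      have : ψ x ∈ Submodule.span R {a} := by
        rw [← hspan]; exact Submodule.subset_span ⟨x, hx, rfl⟩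
      obtain ⟨r, hr⟩ := Submodule.mem_span_singleton.1 this
      exact ⟨r, r.2, hr.symm⟩
    intro w hw
    induction hw using Submodule.mul_induction_on' with
    | mem_mul_mem x hx y hy =>
      rw [Ideal.mem_map_of_equiv] at hy
      obtain ⟨y, hy, rfl⟩ := hy
      obtain ⟨r, hr, hrx⟩ := hgen x hx
      obtain ⟨r', hr', hry⟩ := hgen y hy
      refine ⟨r * star r', mul_mem hr (hR.star_mem hr'), ?_⟩
      have h2 : ψ ((x * conjInt τ y : 𝓞 K) : K) = ψ x * star (ψ y) := by
        rw [hstar, ← map_mul]; rfl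
      rw [h2, hrx, hry, star_mul, mul_assoc, ← mul_assoc a, mul_star_eq_reducedNorm, ← mul_assoc,
        ← Algebra.commutes, mul_assoc]
    | add x hx y hy h1 h2 =>
      obtain ⟨r, hr, hrx⟩ := h1
      obtain ⟨r', hr', hry⟩ := h2
      refine ⟨r + r', add_mem hr hr', ?_⟩
      rw [mul_add, ← hrx, ← hry, ← map_add]; rfl
  -- `nrd(a) ∈ N(I) R`
  have h2 : ∀ u ∈ Submodule.span R ((fun x : 𝓞 K => ψ (x : K)) '' ((I : Ideal (𝓞 K)) : Set (𝓞 K))),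
      ∀ v ∈ Submodule.span R ((fun x : 𝓞 K => ψ (x : K)) '' ((I : Ideal (𝓞 K)) : Set (𝓞 K))),
      ∃ r ∈ R, u * star v = algebraMap ℚ _ (N : ℚ) * r := by
    intro u hu v hv
    induction hu, hv using Submodule.span_induction₂ with
    | mem_mem u v hu hv =>
      obtain ⟨x, hx, rfl⟩ := hu
      obtain ⟨y, hy, rfl⟩ := hv
      have h3 : x * conjInt τ y ∈ Ideal.span {(N : 𝓞 K)} := by
        rw [← hmul]; exact Ideal.mul_mem_mul hx (Ideal.mem_map_of_mem _ hy)
      obtain ⟨z, hz⟩ := Ideal.mem_span_singleton.1 h3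
      refine ⟨ψ z, hψR z, ?_⟩
      have h4 : ψ ((x * conjInt τ y : 𝓞 K) : K) = ψ x * star (ψ y) := by
        rw [hstar, ← map_mul]; rfl
      change ψ x * star (ψ y) = _
      rw [← h4, hz]
      simp
    | zero_left v hv => exact ⟨0, zero_mem R, by simp⟩
    | zero_right u hu => exact ⟨0, zero_mem R, by simp⟩
    | add_left u u' v _ _ _ h h' =>
      obtain ⟨r, hr, h⟩ := h
      obtain ⟨r', hr', h'⟩ := h'
      exact ⟨r + r', add_mem hr hr', by rw [add_mul, h, h', mul_add]⟩
    | add_right u v v' _ _ _ h h' =>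
      obtain ⟨r, hr, h⟩ := h
      obtain ⟨r', hr', h'⟩ := h'
      exact ⟨r + r', add_mem hr hr', by rw [star_add, mul_add, h, h', mul_add]⟩
    | smul_left c u v _ _ h =>
      obtain ⟨r, hr, h⟩ := h
      refine ⟨c * r, mul_mem c.2 hr, ?_⟩
      rw [Subring.smul_def, smul_eq_mul, mul_assoc, h, ← mul_assoc, ← Algebra.commutes, mul_assoc]
    | smul_right c u v _ _ h =>
      obtain ⟨r, hr, h⟩ := h
      refine ⟨r * star (c : ℍ[ℚ,α,β]), mul_mem hr (hR.star_mem c.2), ?_⟩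
      rw [Subring.smul_def, smul_eq_mul, star_mul, ← mul_assoc, h, mul_assoc]
  -- a rational number in `R` is an integer
  have key : ∀ p q : ℚ, p ≠ 0 → (∃ r ∈ R, algebraMap ℚ ℍ[ℚ,α,β] q = algebraMap ℚ _ p * r) →
      ∃ k : ℤ, q = p * k := by
    rintro p q hp ⟨r, hr, h⟩
    have : r = algebraMap ℚ _ (p⁻¹ * q) := by
      rw [map_mul, h, ← mul_assoc, ← map_mul, inv_mul_cancel₀ hp, map_one, one_mul]
    rw [this] at hr
    obtain ⟨k, hk⟩ := hR.exists_int_of_algebraMap_mem hr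
    exact ⟨k, by rw [← hk, mul_inv_cancel_left₀ hp]⟩
  obtain ⟨k, hk⟩ := key (reducedNorm a) N ha.ne' (by
    obtain ⟨r, hr, h⟩ := h1 N (by rw [hmul]; exact Ideal.mem_span_singleton_self _)
    exact ⟨r, hr, by rw [← h]; simp⟩)
  have hamem : a ∈ Submodule.span R
      ((fun x : 𝓞 K => ψ (x : K)) '' ((I : Ideal (𝓞 K)) : Set (𝓞 K))) := by
    rw [hspan]; exact Submodule.mem_span_singleton_self a
  obtain ⟨k', hk'⟩ := key N (reducedNorm a) hNpos.ne' (by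
    obtain ⟨r, hr, h⟩ := h2 a hamem a hamem
    exact ⟨r, hr, by rw [← h, mul_star_eq_reducedNorm]⟩)
  have hkk : k * k' = 1 := by
    have h3 : (N : ℚ) * (k * k') = N * 1 := by
      calc (N : ℚ) * (k * k') = N * k' * k := by ring
        _ = N * 1 := by rw [← hk', ← hk, mul_one]
    exact_mod_cast mul_left_cancel₀ hNpos.ne' h3
  have hkpos : 0 < k := by
    have : (0 : ℚ) < k := by
      rw [hk] at hNpos
      exact (mul_pos_iff_of_pos_left ha).1 hNpos
    exact_mod_cast this
  rw [Int.eq_one_of_mul_eq_one_right hkpos.le hkk] at hk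
  rw [hk, Int.cast_one, mul_one]

end Intertwiner

section Sigma

variable {K : Type*} [Field K] [NumberField K] {α β : ℚ} (hK : Module.finrank ℚ K = 2)
  {τ : K ≃ₐ[ℚ] K} (hτ : τ ≠ AlgEquiv.refl) {R : Subring ℍ[ℚ,α,β]} {M : ℕ}
  (hR : IsEichlerOrder R M) {ψ : K →ₐ[ℚ] ℍ[ℚ,α,β]} (hψ : IsOptimalEmbedding R ψ)
include hK hτ hR hψ

/-- If `ψ ∘ τ` is conjugate by `u` to an embedding in `σ ⋆ [ψ]`, then some `b` with
`b ψ b⁻¹ = ψ ∘ τ` has reduced norm `nrd(u) N(I)`, where `I` has class `σ`. -/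
theorem MemStar.exists_intertwiner {σ : NarrowClassGroup K} {φ : K →ₐ[ℚ] ℍ[ℚ,α,β]}
    (hφ : MemStar R σ ψ φ) {u : ℍ[ℚ,α,β]ˣ}
    (hu : ψ.comp (τ : K →ₐ[ℚ] K) = conjEmbedding u φ) :
    ∃ (I : (Ideal (𝓞 K))⁰) (b : ℍ[ℚ,α,β]), narrowClass I = σ ∧
      reducedNorm b = reducedNorm (u : ℍ[ℚ,α,β]) * Ideal.absNorm (I : Ideal (𝓞 K)) ∧
      ∀ x, b * ψ x = ψ (τ x) * b := by
  obtain ⟨I, a, hI, ha, hspan, γ, -, hγ, rfl⟩ := hφ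
  rw [conjEmbedding_conjEmbedding, conjEmbedding_conjEmbedding, conjEmbedding_eq_iff] at hu
  refine ⟨I, _, hI, ?_, hu⟩
  rw [← reducedNorm_generator hK hτ hu hR hψ (reducedNorm_units_ne_zero _) I ha hspan]
  push_cast
  rw [reducedNorm_mul, reducedNorm_mul, hγ, mul_one]

theorem IsSigma.exists_intertwiner {ω : ℍ[ℚ,α,β]ˣ} {σ : NarrowClassGroup K}
    (h : IsSigma R τ ω ψ σ) :
    ∃ (I : (Ideal (𝓞 K))⁰) (b : ℍ[ℚ,α,β]), narrowClass I = σ ∧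
      reducedNorm b = reducedNorm (ω : ℍ[ℚ,α,β]) * Ideal.absNorm (I : Ideal (𝓞 K)) ∧
      ∀ x, b * ψ x = ψ (τ x) * b := by
  obtain ⟨φ, hφ, γ, -, hγ, hu⟩ := h
  rw [conjEmbedding_conjEmbedding] at hu
  obtain ⟨I, b, hI, hb, h⟩ := hφ.exists_intertwiner hK hτ hR hψ hu
  refine ⟨I, b, hI, ?_, h⟩
  rw [hb, Units.val_mul, reducedNorm_mul, hγ, one_mul]

theorem IsSigmaStar.exists_intertwiner {ωinf ω : ℍ[ℚ,α,β]ˣ}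
    (hωinf : reducedNorm (ωinf : ℍ[ℚ,α,β]) = -1) {σ : NarrowClassGroup K}
    (h : IsSigmaStar R τ ωinf ω ψ σ) :
    ∃ (I : (Ideal (𝓞 K))⁰) (b : ℍ[ℚ,α,β]), narrowClass I = σ ∧
      reducedNorm b = -reducedNorm (ω : ℍ[ℚ,α,β]) * Ideal.absNorm (I : Ideal (𝓞 K)) ∧
      ∀ x, b * ψ x = ψ (τ x) * b := by
  obtain ⟨φ, hφ, γ, -, hγ, hu⟩ := h
  have hu' := congrArg (conjEmbedding ωinf⁻¹) hu
  simp only [conjEmbedding_conjEmbedding, inv_mul_cancel] at hu'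
  have h1 : conjEmbedding 1 (ψ.comp (τ : K →ₐ[ℚ] K)) = ψ.comp (τ : K →ₐ[ℚ] K) :=
    ((conjEmbedding_eq_iff _ _ _).2 fun x => by simp).symm
  rw [h1] at hu'
  obtain ⟨I, b, hI, hb, h⟩ := hφ.exists_intertwiner hK hτ hR hψ hu'
  refine ⟨I, b, hI, ?_, h⟩
  have hinv : reducedNorm ((ωinf⁻¹ : ℍ[ℚ,α,β]ˣ) : ℍ[ℚ,α,β]) = -1 := by
    have h2 := reducedNorm_mul (ωinf : ℍ[ℚ,α,β]) (ωinf⁻¹ : ℍ[ℚ,α,β]ˣ)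
    rw [Units.mul_inv, hωinf, reducedNorm_one] at h2
    linarith
  rw [hb, Units.val_mul, Units.val_mul, reducedNorm_mul, reducedNorm_mul, hγ, hinv]
  ring

end Sigma

/-! ### Norms and classes modulo squares -/

section Norms

variable {K : Type*} [Field K] [NumberField K] (hK : Module.finrank ℚ K = 2) {τ : K ≃ₐ[ℚ] K}
  (hτ : τ ≠ AlgEquiv.refl)
include hK hτ

theorem IsSqrtDiscr.norm_add {s : 𝓞 K} (hs : IsSqrtDiscr τ s) (x y : ℚ) :
    Algebra.norm ℚ (algebraMap ℚ K x + algebraMap ℚ K y * s) =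
      x ^ 2 - NumberField.discr K * y ^ 2 := by
  apply (algebraMap ℚ K).injective
  rw [algebraMap_norm_eq hK hτ, map_add, map_mul, hs.coe_conj, AlgEquiv.commutes,
    AlgEquiv.commutes, map_sub, map_mul, map_pow, map_pow, ← hs.coe_sq]
  ring

theorem exists_norm_mul_of_narrowClass_eq (hreal : 0 < NumberField.discr K)
    {I J : (Ideal (𝓞 K))⁰} (h : narrowClass I = narrowClass J) :
    ∃ z : K, (Ideal.absNorm (J : Ideal (𝓞 K)) : ℚ) =
      Algebra.norm ℚ z * Ideal.absNorm (I : Ideal (𝓞 K)) := by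
  obtain ⟨z, hz, h⟩ := exists_of_narrowClass_eq h
  rw [abs_of_pos (norm_pos_of_totallyPositive hK hτ hreal hz)] at h
  exact ⟨z, h⟩

/-- In a division algebra, anticommuting pairs with squares `(d_K, c N(I))` and `(d_K, c N(J))`
force `I` and `J` to have the same class modulo squares. -/
theorem narrowClass_modSquares_of_pairs {α β : ℚ} {s : 𝓞 K} (hs : IsSqrtDiscr τ s)
    (hdiv : ∀ x : ℍ[ℚ,α,β], reducedNorm x = 0 → x = 0) {c : ℚ} (hc : c ≠ 0)
    (I J : (Ideal (𝓞 K))⁰) (i j i' j' : ℍ[ℚ,α,β])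
    (hi : i * i = algebraMap ℚ _ (NumberField.discr K : ℚ))
    (hj : j * j = algebraMap ℚ _ (c * Ideal.absNorm (I : Ideal (𝓞 K)))) (hij : j * i = -(i * j))
    (hi' : i' * i' = algebraMap ℚ _ (NumberField.discr K : ℚ))
    (hj' : j' * j' = algebraMap ℚ _ (c * Ideal.absNorm (J : Ideal (𝓞 K))))
    (hij' : j' * i' = -(i' * j')) :
    (narrowClass I : ModSquares (NarrowClassGroup K)) = narrowClass J := by
  have hpos : ∀ I : (Ideal (𝓞 K))⁰, c * (Ideal.absNorm (I : Ideal (𝓞 K)) : ℚ) ≠ 0 := fun I =>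
    mul_ne_zero hc (by exact_mod_cast (Ideal.absNorm_pos_of_nonZeroDivisors I).ne')
  have hd : (NumberField.discr K : ℚ) ≠ 0 := by exact_mod_cast NumberField.discr_ne_zero K
  have hj0 : j' ≠ 0 := by
    rintro rfl
    rw [mul_zero, eq_comm, map_eq_zero_iff _ (FaithfulSMul.algebraMap_injective ℚ _)] at hj'
    exact hpos J hj'
  obtain ⟨x, y, h⟩ := exists_norm_ratio hd (hpos I) hdiv i j i' j' hi hj hij hi' hj' hij' hj0
  refine narrowClass_modSquares_of_norm hK hτ I J (algebraMap ℚ K x + algebraMap ℚ K y * s) ?_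
  rw [hs.norm_add hK hτ]
  apply mul_left_cancel₀ hc
  rw [h]
  ring

end Norms

/-! ### The genus character at a represented norm -/

theorem IsDiscr.mul {a b : ℤ} (ha : IsDiscr a) (hb : IsDiscr b) : IsDiscr (a * b) := by
  rw [IsDiscr, Int.mul_emod]
  rcases ha with h | h <;> rcases hb with h' | h' <;> rw [h, h'] <;> decide

theorem IsGenusCharacter.isDiscr_discr {K : Type*} [Field K] [NumberField K]
    {χ : NarrowClassGroup K →* ℤˣ} {d₁ d₂ : ℤ} {χ₁ : DirichletCharacter ℤ d₁.natAbs}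
    {χ₂ : DirichletCharacter ℤ d₂.natAbs} (hχ : IsGenusCharacter χ d₁ d₂ χ₁ χ₂) :
    IsDiscr (NumberField.discr K) := by
  rw [← hχ.mul_eq]
  exact hχ.discr_left.mul hχ.discr_right

/-- If `B` contains an anticommuting pair with squares `d_K` and `-n`, and is unramified at the
prime divisors of `d₁`, then `-n` is locally a norm from `K` at these primes; as `n` is prime to
`d₁`, this gives `χ₁(-n) = 1`. -/
theorem IsGenusCharacter.character_left_eq_one {K : Type*} [Field K] [NumberField K]
    {τ : K ≃ₐ[ℚ] K} {s : 𝓞 K} (hs : IsSqrtDiscr τ s)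
    {χ : NarrowClassGroup K →* ℤˣ} {d₁ d₂ : ℤ} {χ₁ : DirichletCharacter ℤ d₁.natAbs}
    {χ₂ : DirichletCharacter ℤ d₂.natAbs} (hχ : IsGenusCharacter χ d₁ d₂ χ₁ χ₂)
    {α β : ℚ} {n : ℤ} (hn : n ≠ 0) (hcop : IsCoprime n d₁)
    (hram : ∀ (p : ℕ) [Fact p.Prime], (p : ℤ) ∣ d₁ → ¬ IsRamifiedAt α β p)
    (i j : ℍ[ℚ,α,β]) (hi : i * i = algebraMap ℚ _ (NumberField.discr K : ℚ))
    (hj : j * j = algebraMap ℚ _ (-n : ℚ)) (hij : j * i = -(i * j)) :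
    χ₁ ((-n : ℤ) : ZMod d₁.natAbs) = 1 := by
  have hdisc := hχ.isDiscr_discr
  have hzero : ∀ (p : ℕ) [Fact p.Prime], (p : ℤ) ∣ d₁ → ∃ v : Fin 3 → ℚ_[p], v ≠ 0 ∧
      v 0 ^ 2 - NumberField.discr K * v 1 ^ 2 + n * v 2 ^ 2 = 0 := fun p _ hp =>
    exists_padic_zero_of_not_isRamifiedAt (hram p hp) (NumberField.discr_ne_zero K) hn i j hi hj hij
  have hnotunit : ∀ p : ℕ, p.Prime → ¬ IsUnit (p : ℤ) := fun p hp h =>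
    (Nat.prime_iff_prime_int.1 hp).not_isUnit h
  refine quadraticCharacter_eq_one_of_local hχ.character_left hcop.neg_left ?_ ?_
  · intro p hp hp2 hpd
    have : Fact p.Prime := ⟨hp⟩
    obtain ⟨v, hv, h⟩ := hzero p hpd
    obtain ⟨t, ht⟩ := exists_sq_add_of_padic_zero v hv h
      (hpd.trans (Dvd.intro _ hχ.mul_eq)) (by
        rintro ⟨c, hc⟩
        refine hnotunit p hp (hs.fundamental hc ?_)
        -- an odd square is `1` modulo `4`
        obtain ⟨a, ha⟩ := hp.odd_of_ne_two hp2
        have h1 : NumberField.discr K = 4 * (((a : ℤ) ^ 2 + a) * c) + c := by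
          rw [hc, ha]; push_cast; ring
        rw [h1, IsDiscr] at hdisc
        rw [IsDiscr]
        omega)
    exact ⟨t, by rwa [sub_neg_eq_add]⟩
  · rcases hχ.discr_left with h0 | h1
    · right
      obtain ⟨f, rfl⟩ : (4 : ℤ) ∣ d₁ := Int.dvd_of_emod_eq_zero h0
      have hodd : ∀ x : ℤ, IsCoprime x (4 * f) → x % 2 = 1 := by
        rintro x ⟨a, b, hab⟩
        by_contra hx
        obtain ⟨y, rfl⟩ : (2 : ℤ) ∣ x := by omega
        have : 2 * (a * y + b * (2 * f)) = 1 := by linear_combination hab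
        omega
      have hn2 := hodd n hcop
      have hd₂ : d₂ % 4 = 1 := by
        have := hodd d₂ hχ.coprime.symm
        have := hχ.discr_right
        rw [IsDiscr] at this
        omega
      obtain ⟨g, hg⟩ : ∃ g, d₂ = 4 * g + 1 := ⟨d₂ / 4, by omega⟩
      have hK4 : NumberField.discr K = ((2 : ℕ) : ℤ) ^ 2 * (f * d₂) := by
        rw [← hχ.mul_eq]; push_cast; ring
      -- `ℚ_2(√d_K) = ℚ_2(√(f d₂))`, where `f d₂` is congruent to `f` modulo `4 f`
      have hfd : f * d₂ = 4 * (f * g) + f := by rw [hg]; ring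
      have hnot : ¬ IsDiscr (f * d₂) := fun h => hnotunit 2 Nat.prime_two (hs.fundamental hK4 h)
      have hf : f % 4 = 2 ∨ f % 4 = 3 := by
        rw [IsDiscr, hfd] at hnot
        omega
      obtain ⟨v, hv, h⟩ := hzero 2 ⟨2 * f, by push_cast; ring⟩
      have hv' : ![v 0, 2 * v 1, v 2] ≠ 0 := by
        intro h'
        apply hv
        funext k
        have hk := congrFun h' k
        fin_cases k <;> simpa using hk
      obtain ⟨hA, hB⟩ := mod_eight_of_dyadic_zero (e := f * d₂) (n := n) ![v 0, 2 * v 1, v 2] hv' (by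
        rw [hK4] at h
        simp only [Matrix.cons_val]
        push_cast at h ⊢
        linear_combination h) hn2
      rw [hfd] at hA hB
      rcases hf with hf | hf
      · right
        obtain ⟨f', rfl⟩ : (2 : ℤ) ∣ f := by omega
        have h3 : 4 * (2 * f' * g) = 8 * (f' * g) := by ring
        rw [h3] at hB
        refine ⟨by omega, ?_⟩
        rcases hB (by omega) with hB | hB
        · exact Or.inl hB
        · right; omega
      · exact Or.inl ⟨by omega, hA (by omega)⟩
    · exact Or.inl h1

theorem mainTheorem8
    {D M : ℕ} (hD : 1 < D) (hDeven : Even D.primeFactors.card)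
    (hM : Squarefree M) (hMD : M.Coprime D)
    {α β : ℚ} (hB : HasQuaternionDiscriminant α β D)
    (K : Type*) [Field K] [NumberField K] (hK : Module.finrank ℚ K = 2)
    (hreal : 0 < NumberField.discr K)
    (hinert : ∀ ℓ : ℕ, ℓ.Prime → ℓ ∣ D → (Ideal.span {(ℓ : 𝓞 K)}).IsPrime)
    (hsplit : ∀ ℓ : ℕ, ℓ.Prime → ℓ ∣ M →
      ((Ideal.span {(ℓ : ℤ)}).primesOver (𝓞 K)).ncard = 2)
    (τ : K ≃ₐ[ℚ] K) (hτ : τ ≠ AlgEquiv.refl)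
    (R : Subring ℍ[ℚ,α,β]) (hR : IsEichlerOrder R M)
    (ωinf ω : ℍ[ℚ,α,β]ˣ)
    (hωinf : (ωinf : ℍ[ℚ,α,β]) ∈ R ∧ reducedNorm (ωinf : ℍ[ℚ,α,β]) = -1)
    (hω : IsAtkinLehnerElement R (M * D) ω) :
    -- the isomorphism `B ≃ (d_K, MD N(𝔞) / ℚ)`, which determines the class of `σ_𝔞` in `G / G²`
    (∀ ψ : K →ₐ[ℚ] ℍ[ℚ,α,β], IsOptimalEmbedding R ψ →
      ∀ 𝔞 : (Ideal (𝓞 K))⁰, IsSigmaStar R τ ωinf ω ψ (narrowClass 𝔞) →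
        Nonempty (ℍ[ℚ,α,β] ≃ₐ[ℚ]
          ℍ[ℚ,(NumberField.discr K : ℚ),(M * D * Ideal.absNorm (𝔞 : Ideal (𝓞 K)) : ℚ)]) ∧
        ∀ 𝔟 : (Ideal (𝓞 K))⁰,
          Nonempty (ℍ[ℚ,α,β] ≃ₐ[ℚ]
            ℍ[ℚ,(NumberField.discr K : ℚ),(M * D * Ideal.absNorm (𝔟 : Ideal (𝓞 K)) : ℚ)]) →
          (narrowClass 𝔞 : ModSquares (NarrowClassGroup K)) = narrowClass 𝔟) ∧
    -- the class of `σ_ψ` in `G / G²` does not depend on `ψ`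
    (∀ ψ ψ' : K →ₐ[ℚ] ℍ[ℚ,α,β], IsOptimalEmbedding R ψ → IsOptimalEmbedding R ψ' →
      ∀ σ σ' : NarrowClassGroup K, IsSigma R τ ω ψ σ → IsSigma R τ ω ψ' σ' →
        (σ : ModSquares (NarrowClassGroup K)) = σ') ∧
    -- the value of the genus characters at `σ_ψ`
    (∀ ψ : K →ₐ[ℚ] ℍ[ℚ,α,β], IsOptimalEmbedding R ψ →
      ∀ σ : NarrowClassGroup K, IsSigma R τ ω ψ σ →
        ∀ (χ : NarrowClassGroup K →* ℤˣ) (d₁ d₂ : ℤ) (χ₁ : DirichletCharacter ℤ d₁.natAbs)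
          (χ₂ : DirichletCharacter ℤ d₂.natAbs), IsGenusCharacter χ d₁ d₂ χ₁ χ₂ →
          ((χ σ : ℤˣ) : ℤ) = χ₁ ((-(M * D : ℤ) : ℤ) : ZMod d₁.natAbs)) := by
  obtain ⟨s, hs⟩ := exists_isSqrtDiscr hK hτ
  have hdiv := hB.eq_zero_of_reducedNorm hD
  have hM0 : M ≠ 0 := hM.ne_zero
  have hD0 : D ≠ 0 := by omega
  have hMD0 : (M * D : ℚ) ≠ 0 := by exact_mod_cast mul_ne_zero hM0 hD0
  have hd0 : (NumberField.discr K : ℚ) ≠ 0 := by exact_mod_cast hreal.ne'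
  have hωn : reducedNorm (ω : ℍ[ℚ,α,β]) = M * D := by rw [hω.norm_eq]; push_cast; rfl
  refine ⟨?_, ?_, ?_⟩
  · intro ψ hψ 𝔞 h𝔞
    obtain ⟨I, b, hI, hb, hbψ⟩ := h𝔞.exists_intertwiner hK hτ hR hψ hωinf.2
    obtain ⟨z, hz⟩ := exists_norm_mul_of_narrowClass_eq hK hτ hreal hI
    have hsq : ψ z * b * (ψ z * b) =
        algebraMap ℚ _ (M * D * Ideal.absNorm (𝔞 : Ideal (𝓞 K)) : ℚ) := by
      rw [intertwiner_mul_self hK hτ hbψ, hb, hz, hωn]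
      congr 1
      ring
    have hm0 : (M * D * Ideal.absNorm (𝔞 : Ideal (𝓞 K)) : ℚ) ≠ 0 :=
      mul_ne_zero hMD0 (by exact_mod_cast (Ideal.absNorm_pos_of_nonZeroDivisors 𝔞).ne')
    refine ⟨⟨(QuaternionAlgebra.equivOfPair hd0 hm0 (ψ s) (ψ z * b) (embedding_sqrtDiscr_mul_self hs)
      hsq (intertwiner_anticommute hbψ hs z)).symm⟩, ?_⟩
    rintro 𝔟 ⟨e⟩
    -- the images of the standard generators `i`, `j` of `(d_K, MD N(𝔟) / ℚ)`
    refine narrowClass_modSquares_of_pairs hK hτ hs hdiv hMD0 𝔞 𝔟 (ψ s) (ψ z * b)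
      (e.symm ⟨0, 1, 0, 0⟩) (e.symm ⟨0, 0, 1, 0⟩) (embedding_sqrtDiscr_mul_self hs) hsq
      (intertwiner_anticommute hbψ hs z) ?_ ?_ ?_
    · rw [← map_mul, ← AlgEquiv.commutes e.symm]
      congr 1
      ext <;> simp
    · rw [← map_mul, ← AlgEquiv.commutes e.symm]
      congr 1
      ext <;> simp [QuaternionAlgebra.algebraMap_eq]
    · rw [← map_mul, ← map_mul, ← map_neg]
      congr 1
      ext <;> simp
  · intro ψ ψ' hψ hψ' σ σ' hσ hσ'
    obtain ⟨I, b, rfl, hb, hbψ⟩ := hσ.exists_intertwiner hK hτ hR hψ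
    obtain ⟨I', b', rfl, hb', hbψ'⟩ := hσ'.exists_intertwiner hK hτ hR hψ'
    refine narrowClass_modSquares_of_pairs hK hτ hs hdiv (neg_ne_zero.2 hMD0) I I' (ψ s) (ψ 1 * b)
      (ψ' s) (ψ' 1 * b') (embedding_sqrtDiscr_mul_self hs) ?_ (intertwiner_anticommute hbψ hs 1)
      (embedding_sqrtDiscr_mul_self hs) ?_ (intertwiner_anticommute hbψ' hs 1)
    · rw [intertwiner_mul_self hK hτ hbψ, hb, hωn, map_one]
      congr 1
      ring
    · rw [intertwiner_mul_self hK hτ hbψ', hb', hωn, map_one]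
      congr 1
      ring
  · intro ψ hψ σ hσ χ d₁ d₂ χ₁ χ₂ hχ
    obtain ⟨I, b, rfl, hb, hbψ⟩ := hσ.exists_intertwiner hK hτ hR hψ
    have hd₁0 : d₁ ≠ 0 := by
      rintro rfl
      exact hreal.ne' (by rw [← hχ.mul_eq, zero_mul])
    -- replace `I` by an ideal `J` of the same class and of norm prime to `d₁`
    obtain ⟨J, hJI, hJ⟩ := exists_narrowClass_eq_coprime hK hτ hreal I (Int.natAbs_ne_zero.2 hd₁0)
    obtain ⟨z, hz⟩ := exists_norm_mul_of_narrowClass_eq hK hτ hreal hJI.symm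
    set N : ℕ := Ideal.absNorm (J : Ideal (𝓞 K)) with hN
    have hdvd : d₁ ∣ NumberField.discr K := Dvd.intro _ hχ.mul_eq
    have hcopD : ∀ p : ℕ, p.Prime → (p : ℤ) ∣ d₁ → ¬ p ∣ D := fun p hp hpd hpD =>
      not_dvd_discr_of_inert hK hτ hχ.isDiscr_discr hp (hinert p hp hpD) (hpd.trans hdvd)
    have hcopM : ∀ p : ℕ, p.Prime → (p : ℤ) ∣ d₁ → ¬ p ∣ M := fun p hp hpd hpM =>
      not_dvd_discr_of_split hK hτ (hsplit p hp hpM) (hpd.trans hdvd)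
    have hcop : (M * D).Coprime d₁.natAbs := by
      refine Nat.Coprime.mul_left ?_ ?_
      · exact Nat.coprime_of_dvd fun p hp hpM hpd => hcopM p hp (Int.natCast_dvd.2 hpd) hpM
      · exact Nat.coprime_of_dvd fun p hp hpD hpd => hcopD p hp (Int.natCast_dvd.2 hpd) hpD
    have hone : χ₁ ((-((M * D : ℕ) * N : ℤ) : ℤ) : ZMod d₁.natAbs) = 1 := by
      have hN0 : N ≠ 0 := (Ideal.absNorm_pos_of_nonZeroDivisors J).ne'
      refine hχ.character_left_eq_one hs (α := α) (β := β) ?_ ?_ ?_ (ψ s) (ψ z * b)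
        (embedding_sqrtDiscr_mul_self hs) ?_ (intertwiner_anticommute hbψ hs z)
      · exact_mod_cast mul_ne_zero (mul_ne_zero hM0 hD0) hN0
      · rw [Int.isCoprime_iff_nat_coprime, ← Nat.cast_mul, Int.natAbs_natCast]
        exact hcop.mul_left hJ
      · intro p hp hpd hram
        exact hcopD p hp.out hpd ((hB.ramified_iff p).1 hram)
      · rw [intertwiner_mul_self hK hτ hbψ, hb, hωn]
        congr 1
        push_cast
        rw [hz]
        ring
    have hsplitχ : χ₁ ((-((M * D : ℕ) * N : ℤ) : ℤ) : ZMod d₁.natAbs) =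
        χ₁ ((-(M * D : ℤ) : ℤ) : ZMod d₁.natAbs) * χ₁ (N : ZMod d₁.natAbs) := by
      rw [← map_mul]
      congr 1
      push_cast
      ring
    rw [hsplitχ] at hone
    rw [← hJI, hχ.apply_narrowClass hK hτ J hJ, ← hN]
    have hsq := quadraticCharacter_sq (χ := χ₁) hJ
    linear_combination χ₁ ((-(M * D : ℤ) : ℤ) : ZMod d₁.natAbs) * hsq -
      χ₁ (N : ZMod d₁.natAbs) * hone
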